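/- For every $n \ge 0$ let $\pi_n$ be a permutation of $\{0,1\}^n$, and let $\pi:\{0,1\}^*\to\{0,1\}^*$ be the length-preserving function that acts as $\pi_n$ on $\{0,1\}^n$. The permutation oracle of $\pi$ is the Boolean function on $\{0,1\}^*$ that gives, on the code $1^i0x$ of a pair $(x,i)$, the bit of index $i$ of $\pi(x)$ (counted from $0$), and that is $0$ if there is no such bit and on strings that are not codes. The oracle is random when the $\pi_n$ are independent and each $\pi_n$ is uniformly distributed among the permutations of $\{0,1\}^n$. An oracle machine (deterministic or quantum) has finitely many two-way infinite tapes over the alphabet $\{0,1,\text{blank}\}$, one of them a query tape. Whenever it is in its pre-query state, it takes one step to its post-query state, in which a query tape whose non-blank cells form one block $x\circ b$ ($x\in\{0,1\}^*$, $b\in\{0,1\}$) is changed to $x\circ(b\oplus A(x))$, $A$ being the oracle; a blank (or fragmented) query tape does not change. A quantum machine is given by transition amplitudes whose real and imaginary parts can be approximated to within $2^{-n}$ in deterministic time polynomial in $n$, and it is well-formed if its time evolution preserves the Euclidean norm. It halts at time $t$ if at time $t$ its superposition contains only configurations in the final state and at no earlier time contains any such configuration. **Corollary 3.7.** With probability $1$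 over a random permutation oracle, the function $\pi$ is a quantum one-way permutation relative to the oracle, in the following sense. $\pi$ is a length-preserving permutation of $\{0,1\}^*$, and: 1. $\pi$ is computed in polynomial time by a deterministic classical Turing machine that has access to the oracle; the machine and the polynomial do not depend on $\pi$. 2. Inverting $\pi$ takes time $\Omega(2^{n/3})$ on a quantum machine with access to the oracle: if $M$ is a well-formed oracle quantum Turing machine and $T:\mathbb N\to\mathbb N$ is such that for every $x$, on input $\pi(x)$ of length $n$, $M$ halts within $T(n)$ steps and its final superposition, when observed, gives the output $x$ with probability at least $2/3$, then there is a constant $c>0$ such that $T(n)\ge c\,2^{n/3}$ for all sufficiently large $n$. -/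

import Mathlib

open MeasureTheory

noncomputable section

namespace OracleTM

/-! ### Tapes -/

/-- The tape alphabet: a blank, and the two bits. -/
inductive Sym where
  | blank : Sym
  | bit : Bool → Sym
  deriving DecidableEq, Fintype

instance : Zero Sym := ⟨Sym.blank⟩

/-- A two-way infinite tape, all but finitely many cells of which are blank. -/
abbrev Tape := ℤ →₀ Sym

/-- The content of cell `z` when the word `w` is written from cell `a` on. -/
def wordCell (a : ℤ) (w : List Bool) (z : ℤ) : Sym :=
  if a ≤ z then (w[(z - a).toNat]?).elim Sym.blank Sym.bit else Sym.blank

/-- The tape that holds the word `w` in the cells `a, a + 1, …, a + |w| - 1` and is blank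
elsewhere. -/
def wordTape (a : ℤ) (w : List Bool) : Tape :=
  Finsupp.onFinset (Finset.Ico a (a + w.length)) (wordCell a w) (by
    intro z hz
    rw [Finset.mem_Ico]
    by_cases h : a ≤ z
    · refine ⟨h, ?_⟩
      by_contra h2
      apply hz
      have h3 : w[(z - a).toNat]? = none := by
        rw [List.getElem?_eq_none_iff]
        omega
      simp only [wordCell, h, h3, if_true, Option.elim_none]
      rfl
    · exact absurd (by simp only [wordCell, h, if_false]; rfl) hz)

/-- The tape is blank except for one contiguous block, which spells `w`. -/
def Holds (t : Tape) (w : List Bool) : Prop := ∃ a : ℤ, t = wordTape a w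

/-- A Boolean oracle. -/
abbrev Oracle := List Bool → Bool

open Classical in
/-- The effect of a call to the oracle `A` on the query tape: if the tape holds a single nonempty
block `x ∘ b`, then that block is replaced by `x ∘ (b ⊕ A x)` (the data `a`, `x`, `b` are determined
by the tape); otherwise, in particular if the tape is blank, nothing happens. -/
def callTape (A : Oracle) (t : Tape) : Tape :=
  if h : ∃ q : ℤ × List Bool × Bool, t = wordTape q.1 (q.2.1 ++ [q.2.2]) then
    wordTape h.choose.1 (h.choose.2.1 ++ [xor h.choose.2.2 (A h.choose.2.1)])
  else t

/-! ### Machines with a query tape -/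

/-- A head movement. -/
inductive Move where
  | left : Move
  | stay : Move
  | right : Move
  deriving DecidableEq

instance : Fintype Move :=
  ⟨{Move.left, Move.stay, Move.right}, fun m => by cases m <;> decide⟩

/-- The displacement of a head. -/
def Move.shift : Move → ℤ
  | Move.left => -1
  | Move.stay => 0
  | Move.right => 1

/-- The data common to deterministic and quantum oracle machines: finitely many states, with the
initial, final, pre-query and post-query ones distinguished, and `work + 2` tapes. Tape `0` holds the
input, tape `1` is the query tape, and the output is read from tape `out`. -/
structure Frame where
  states : ℕ
  work : ℕ
  start : Fin states
  final : Fin states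
  query : Fin states
  answer : Fin states
  out : Fin (work + 2)
  start_ne_final : start ≠ final
  query_ne_answer : query ≠ answer

/-- The symbols under the heads (or to be written by the heads). -/
abbrev Frame.Scan (F : Frame) := Fin (F.work + 2) → Sym

/-- What a machine does in one step: a new state, and for every tape a symbol to write and a
movement. -/
abbrev Frame.Action (F : Frame) := Fin F.states × F.Scan × (Fin (F.work + 2) → Move)

/-- A configuration. -/
structure Config (F : Frame) where
  state : Fin F.states
  tape : Fin (F.work + 2) → Tape
  head : Fin (F.work + 2) → ℤ

variable {F : Frame}

/-- The symbols under the heads. -/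
def Config.scan (c : Config F) : F.Scan := fun j => c.tape j (c.head j)

/-- The configuration after an action. -/
def Config.act (c : Config F) (a : F.Action) : Config F where
  state := a.1
  tape := fun j => (c.tape j).update (c.head j) (a.2.1 j)
  head := fun j => c.head j + (a.2.2 j).shift

/-- The configuration after a call to the oracle: control passes to the post-query state, the query
tape changes, and nothing else does. -/
def Config.call (A : Oracle) (c : Config F) : Config F where
  state := F.answer
  tape := Function.update c.tape 1 (callTape A (c.tape 1))
  head := c.head

/-- The initial configuration on input `x`: `x` stands on tape `0` from cell `0` on, all other cells
are blank, all heads are on cell `0`. -/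
def Config.init (F : Frame) (x : List Bool) : Config F where
  state := F.start
  tape := fun j => if j = 0 then wordTape 0 x else 0
  head := fun _ => 0

/-- The output tape holds `w`. -/
def Config.Outputs (c : Config F) (w : List Bool) : Prop := Holds (c.tape F.out) w

/-! ### Deterministic oracle machines -/

/-- A deterministic oracle Turing machine. -/
structure DetMachine extends Frame where
  delta : Fin states → toFrame.Scan → toFrame.Action

namespace DetMachine

/-- One step; a query costs one step. -/
def step (M : DetMachine) (A : Oracle) (c : Config M.toFrame) : Config M.toFrame :=
  if c.state = M.query then c.call A else c.act (M.delta c.state c.scan)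

/-- The configuration at time `t` on input `x`. -/
def run (M : DetMachine) (A : Oracle) (x : List Bool) (t : ℕ) : Config M.toFrame :=
  (M.step A)^[t] (Config.init M.toFrame x)

/-- The machine is in the final state at time `t`, and not earlier. -/
def HaltsAt (M : DetMachine) (A : Oracle) (x : List Bool) (t : ℕ) : Prop :=
  (M.run A x t).state = M.final ∧ ∀ s < t, (M.run A x s).state ≠ M.final

/-- With oracle `A`, the machine computes `f`, in at most `T n` steps on each input of length `n`. -/
def ComputesInTime (M : DetMachine) (A : Oracle) (f : List Bool → List Bool) (T : ℕ → ℕ) : Prop :=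
  ∀ x, ∃ t ≤ T x.length, M.HaltsAt A x t ∧ (M.run A x t).Outputs (f x)

end DetMachine

/-! ### Amplitudes -/

/-- The dyadic rational `± k / 2 ^ n` named by a word: a sign bit, and then the binary digits of `k`,
the least significant one first. -/
def dyadic (n : ℕ) : List Bool → ℝ
  | [] => 0
  | s :: w => (if s then -1 else 1) * (Nat.ofDigits 2 (w.map Bool.toNat) : ℕ) / 2 ^ n

/-- Real numbers that can be approximated to within `2 ^ (-n)` in deterministic time polynomial in
`n` (no oracle: the oracle that is constantly `0`). -/
def PolyTimeReal (r : ℝ) : Prop :=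
  ∃ (M : DetMachine) (f : List Bool → List Bool) (p : Polynomial ℕ),
    M.ComputesInTime (fun _ => false) f (fun n => p.eval n) ∧
    ∀ n : ℕ, |r - dyadic n (f (List.replicate n true))| ≤ 1 / 2 ^ n

/-- The complex numbers that are allowed as transition amplitudes. -/
def Amplitudes : Set ℂ := {z | PolyTimeReal z.re ∧ PolyTimeReal z.im}

/-! ### Quantum oracle machines -/

/-- An oracle quantum Turing machine, given by its quantum transition function. -/
structure QuantumMachine extends Frame where
  amp : Fin states → toFrame.Scan → toFrame.Action → ℂ
  amp_mem : ∀ q s a, amp q s a ∈ Amplitudes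

/-- Superpositions of configurations. -/
abbrev Superposition (F : Frame) := Config F →₀ ℂ

/-- The sum of the squared magnitudes of the configurations that satisfy `P`. -/
def weight (φ : Superposition F) (P : Config F → Prop) : ℝ :=
  open Classical in φ.sum fun c z => if P c then ‖z‖ ^ 2 else 0

namespace QuantumMachine

/-- The superposition one step after a configuration; a query costs one step. -/
def stepConfig (M : QuantumMachine) (A : Oracle) (c : Config M.toFrame) :
    Superposition M.toFrame :=
  if c.state = M.query then Finsupp.single (c.call A) 1
  else ∑ a : M.toFrame.Action, Finsupp.single (c.act a) (M.amp c.state c.scan a)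

/-- The time evolution operator with oracle `A`: the linear extension of `stepConfig`. -/
def evolve (M : QuantumMachine) (A : Oracle) :
    Superposition M.toFrame →ₗ[ℂ] Superposition M.toFrame :=
  Finsupp.linearCombination ℂ (M.stepConfig A)

/-- The machine is well-formed: time evolution preserves the Euclidean norm. (As an oracle call
permutes the configurations of the query tape, this does not depend on the oracle.) -/
def WellFormed (M : QuantumMachine) : Prop :=
  ∀ (A : Oracle) (φ : Superposition M.toFrame),
    weight (M.evolve A φ) (fun _ => True) = weight φ (fun _ => True)

/-- The superposition at time `t` on input `x`. -/
def run (M : QuantumMachine) (A : Oracle) (x : List Bool) (t : ℕ) : Superposition M.toFrame :=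
  (M.evolve A)^[t] (Finsupp.single (Config.init M.toFrame x) 1)

/-- At time `t` the superposition contains only final configurations, and at any earlier time it
contains none. -/
def HaltsAt (M : QuantumMachine) (A : Oracle) (x : List Bool) (t : ℕ) : Prop :=
  (∀ c ∈ (M.run A x t).support, c.state = M.final) ∧
    ∀ s < t, ∀ c ∈ (M.run A x s).support, c.state ≠ M.final

/-- With oracle `A`, the machine inverts `f`, in at most `T n` steps on each input of length `n`:
on input `f x` it halts in time, and observing the final superposition then yields the output `x`
with probability at least `2 / 3`. -/
def InvertsInTime (M : QuantumMachine) (A : Oracle) (f : List Bool → List Bool) (T : ℕ → ℕ) :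
    Prop :=
  ∀ x, ∃ t ≤ T (f x).length, M.HaltsAt A (f x) t ∧
    2 / 3 ≤ weight (M.run A (f x) t) (fun c => c.Outputs x)

end QuantumMachine

/-! ### Random permutation oracles -/

/-- A permutation of `{0,1} ^ n` for every `n`. -/
abbrev Permutations := (n : ℕ) → Equiv.Perm (Fin n → Bool)

/-- The length-preserving function `{0,1}* → {0,1}*` given by a family of permutations. -/
def Permutations.toFun (π : Permutations) (x : List Bool) : List Bool :=
  List.ofFn (π x.length x.get)

/-- The pairing function: `(x, i)` is encoded as `1 ^ i 0 x`. -/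
def pair (x : List Bool) (i : ℕ) : List Bool := List.replicate i true ++ false :: x

/-- The permutation oracle of a family of permutations, as a Boolean function: on the code of
`(x, i)` it gives the bit of index `i` (counted from `0`) of the image of `x`, see `oracle_pair`; it
is `0` if there is no such bit, and on strings that are not codes. -/
def Permutations.oracle (π : Permutations) : Oracle := fun w =>
  ((π.toFun (w.dropWhile id).tail)[(w.takeWhile id).length]?).getD false

theorem oracle_pair (π : Permutations) (x : List Bool) (i : ℕ) :
    π.oracle (pair x i) = ((π.toFun x)[i]?).getD false := by
  have h1 : (pair x i).takeWhile id = List.replicate i true := by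
    induction i with
    | zero => simp [pair]
    | succ k ih => simp [pair]
  have h2 : (pair x i).dropWhile id = false :: x := by
    simp [pair]
  simp [Permutations.oracle, h1, h2]

instance (n : ℕ) : MeasurableSpace (Equiv.Perm (Fin n → Bool)) := ⊤

/-- The law of a random permutation oracle: independently for every `n`, a uniformly distributed
permutation of `{0,1} ^ n`. -/
def randomPermutations : Measure Permutations :=
  Measure.infinitePi fun n => (PMF.uniformOfFintype (Equiv.Perm (Fin n → Bool))).toMeasure

end OracleTM

end

/-! The upper bound is an explicit machine (`Evaluator.machine`) that asks for the bits of `π x` one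
after another. The lower bound combines a hybrid argument with a resampling of the permutation,
followed by Borel–Cantelli.

Fix a machine, a length `n`, a target `y` and all permutations at the other lengths. Take a
permutation and make two variants of it, by moving the preimage of `y` to a point `z` and to a point
`z'`. The variants `ρ`, `ρ'` differ only at `z`, `z'` and the old preimage `c`, but a machine that
inverts both must answer `z` with one and `z'` with the other. A machine may query the preimage
heavily to verify its guess, so the two runs are not compared directly: both are compared with a
hybrid oracle that follows `ρ` at `z` and `ρ'` elsewhere, so that `y` has two preimages. It differs
from `ρ` only at `z'` and `c`, and from `ρ'` only at `z`. Hence one of these points carries large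
query weight in the corresponding run (`le_queryWeight`). Total query weight is at most the running
time `τ`, so only `O(τ ^ 2)` points are heavy in any run.

For random `z`, `z'`, a given one of these coincidences is therefore improbable, and Cauchy–Schwarz
turns this bound on pairs into one on the proportion of inverted permutations: its square is `O(τ ^
2 / 2 ^ n)` (`card_sq_mul_card_le`, `card_finds_le`). With `τ` about `2 ^ (n / 3)` the proportion is
`O(2 ^ (-n / 6))`, which is summable over `n`. Almost surely a given machine thus fails at all large
lengths, and there are only countably many machines because the admissible amplitudes are countable.
-/

namespace OracleTM

/-! ### Counting permutations by moving a preimage. -/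

section Transpositions

variable {X : Type*} [DecidableEq X]

/-- The permutation that takes the value `y` at `z`, obtained from `π` by exchanging two values. -/
def moveTo (y : X) (π : Equiv.Perm X) (z : X) : Equiv.Perm X :=
  π * Equiv.swap (π.symm y) z

theorem moveTo_symm_apply (y : X) (π : Equiv.Perm X) (z : X) :
    (moveTo y π z).symm y = z := by
  rw [Equiv.symm_apply_eq]
  simp [moveTo]

theorem moveTo_moveTo (y : X) (π : Equiv.Perm X) (z : X) :
    moveTo y (moveTo y π z) (π.symm y) = π := by
  have h := moveTo_symm_apply y π z
  rw [moveTo, h, moveTo, mul_assoc, Equiv.swap_comm, Equiv.swap_mul_self, mul_one]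

theorem moveTo_apply_of_ne (y : X) (π : Equiv.Perm X) {z x : X} (h1 : x ≠ π.symm y) (h2 : x ≠ z) :
    moveTo y π z x = π x := by
  simp [moveTo, Equiv.swap_apply_of_ne_of_ne h1 h2]

variable [Fintype X]

/-- The map `(π, z) ↦ (moveTo y π z, π.symm y)` is an involution: the discarded preimage is exactly
what is needed to undo the move. So for uniform `(π, z)` the moved permutation and the old preimage
are again uniform and independent. -/
theorem sum_moveTo (y : X) (g : Equiv.Perm X → X → ℕ) :
    ∑ π : Equiv.Perm X, ∑ z : X, g (moveTo y π z) (π.symm y) =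
      ∑ π : Equiv.Perm X, ∑ z : X, g π z := by
  rw [← Fintype.sum_prod_type', ← Fintype.sum_prod_type']
  let e : Equiv.Perm X × X ≃ Equiv.Perm X × X :=
    Function.Involutive.toPerm (fun p => (moveTo y p.1 p.2, p.1.symm y)) (fun p => by
      simp only [moveTo_moveTo, moveTo_symm_apply])
  exact Fintype.sum_equiv e _ _ (fun p => rfl)

/-- A set of permutations is small if any two of its members which differ in at most three points,
and in the place of `y`, are told apart by membership of one of these points in a small set. -/
theorem card_sq_mul_card_le (y : X) (S : Finset (Equiv.Perm X)) (B : Equiv.Perm X → Finset X)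
    (b : ℕ) (hB : ∀ ρ, (B ρ).card ≤ b)
    (h : ∀ ρ ∈ S, ∀ ρ' ∈ S, ∀ c, ρ.symm y ≠ ρ'.symm y →
      (∀ x, x ≠ ρ.symm y → x ≠ ρ'.symm y → x ≠ c → ρ x = ρ' x) →
      ρ'.symm y ∈ B ρ ∨ c ∈ B ρ ∨ ρ.symm y ∈ B ρ') :
    S.card ^ 2 * Fintype.card X ≤ Fintype.card (Equiv.Perm X) ^ 2 * (3 * b + 1) := by
  set N := Fintype.card X with hN
  set P := Fintype.card (Equiv.Perm X) with hP
  have hNpos : 0 < N := Fintype.card_pos_iff.2 ⟨y⟩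
  -- `a π` counts the moves of `π` that land in `S`. Its mean is known from `sum_moveTo`, and its
  -- square counts pairs of moves of the same `π`, to which `h` applies.
  let a : Equiv.Perm X → ℕ := fun π => ∑ z : X, if moveTo y π z ∈ S then 1 else 0
  have ha : ∑ π, a π = N * S.card := by
    have := sum_moveTo y (fun π _ => if π ∈ S then 1 else 0)
    simp only [a]
    rw [this]
    simp [Finset.sum_ite_mem, hN, mul_comm]
  have hcs : (∑ π, a π) ^ 2 ≤ P * ∑ π, a π ^ 2 := by
    have := sq_sum_le_card_mul_sum_sq (s := (Finset.univ : Finset (Equiv.Perm X))) (f := a)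
    simpa [hP] using this
  have hBs : ∀ ρ, ∑ z : X, (if z ∈ B ρ then 1 else 0) ≤ b := by
    intro ρ
    simpa using hB ρ
  -- The diagonal `z = z'` gives the `1` in `3 * b + 1`. Off it, `h` is applied with `c = π.symm y`,
  -- and its three alternatives give the three other terms.
  have hpt : ∀ π : Equiv.Perm X, a π ^ 2 ≤ ∑ z : X, ∑ z' : X,
      ((if z = z' then 1 else 0) + (if z' ∈ B (moveTo y π z) then 1 else 0)
        + (if z ∈ B (moveTo y π z') then 1 else 0)
        + (if π.symm y ∈ B (moveTo y π z) then 1 else 0)) := by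
    intro π
    rw [pow_two, Finset.sum_mul_sum]
    refine Finset.sum_le_sum fun z _ => Finset.sum_le_sum fun z' _ => ?_
    by_cases h1 : moveTo y π z ∈ S
    swap
    · simp [h1]
    by_cases h2 : moveTo y π z' ∈ S
    swap
    · simp [h2]
    by_cases h3 : z = z'
    · subst h3
      simp only [h1, if_true]
      omega
    have := h _ h1 _ h2 (π.symm y) (by simpa [moveTo_symm_apply] using h3) (by
      intro x hx1 hx2 hx3
      rw [moveTo_symm_apply] at hx1 hx2
      rw [moveTo_apply_of_ne y π hx3 hx1, moveTo_apply_of_ne y π hx3 hx2])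
    rw [moveTo_symm_apply, moveTo_symm_apply] at this
    simp only [h1, h2, if_true]
    rcases this with h | h | h <;> simp only [h, if_true] <;> omega
  have hsum : ∑ π, a π ^ 2 ≤ P * (N * (3 * b + 1)) := by
    refine (Finset.sum_le_sum fun π _ => hpt π).trans ?_
    simp only [Finset.sum_add_distrib]
    have e1 : ∑ π : Equiv.Perm X, ∑ z : X, ∑ z' : X, (if z = z' then 1 else 0) = P * N := by
      simp [hP, hN]
    have e2 : ∑ π : Equiv.Perm X, ∑ z : X, ∑ z' : X,
        (if z' ∈ B (moveTo y π z) then 1 else 0) ≤ P * (N * b) := by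
      calc _ ≤ ∑ π : Equiv.Perm X, ∑ z : X, b :=
            Finset.sum_le_sum fun π _ => Finset.sum_le_sum fun z _ => hBs _
        _ = _ := by simp [hP, hN]
    have e3 : ∑ π : Equiv.Perm X, ∑ z : X, ∑ z' : X,
        (if z ∈ B (moveTo y π z') then 1 else 0) ≤ P * (N * b) := by
      refine le_trans (le_of_eq ?_) e2
      refine Finset.sum_congr rfl fun π _ => ?_
      rw [Finset.sum_comm]
    -- Here the tested point is the old preimage, not a summation variable; the involution makes it
    -- one.
    have e4 : ∑ π : Equiv.Perm X, ∑ z : X, ∑ z' : X,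
        (if π.symm y ∈ B (moveTo y π z) then 1 else 0) ≤ P * (N * b) := by
      have := sum_moveTo y (fun π z => ∑ z' : X, if z ∈ B π then 1 else 0)
      rw [this]
      calc _ = ∑ π : Equiv.Perm X, ∑ z' : X, ∑ z : X, (if z ∈ B π then 1 else 0) :=
            Finset.sum_congr rfl fun π _ => Finset.sum_comm
        _ ≤ ∑ π : Equiv.Perm X, ∑ z' : X, b :=
            Finset.sum_le_sum fun π _ => Finset.sum_le_sum fun z _ => hBs _
        _ = _ := by simp [hP, hN]
    calc _ ≤ P * N + P * (N * b) + P * (N * b) + P * (N * b) := by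
            gcongr
            exact e1.le
      _ = _ := by ring
  have h1 : (N * S.card) ^ 2 ≤ P * (P * (N * (3 * b + 1))) := by
    rw [← ha]
    exact hcs.trans (Nat.mul_le_mul_left _ hsum)
  have h2 : N * (S.card ^ 2 * N) ≤ N * (P ^ 2 * (3 * b + 1)) := by
    calc _ = (N * S.card) ^ 2 := by ring
      _ ≤ _ := h1
      _ = _ := by ring
  exact Nat.le_of_mul_le_mul_left h2 hNpos

end Transpositions

/-! ### Words on tapes -/

theorem wordCell_ne_blank (a : ℤ) (w : List Bool) (z : ℤ) :
    wordCell a w z ≠ Sym.blank ↔ a ≤ z ∧ z < a + w.length := by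
  unfold wordCell
  split_ifs with h
  · rcases lt_or_ge (z - a).toNat w.length with h1 | h1
    · simp only [List.getElem?_eq_getElem h1, Option.elim_some, ne_eq, reduceCtorEq,
        not_false_eq_true, true_iff]
      omega
    · simp only [List.getElem?_eq_none h1, Option.elim_none, ne_eq, not_true_eq_false, false_iff]
      omega
  · simp only [ne_eq, not_true_eq_false, false_iff]
    omega

theorem wordCell_add (a : ℤ) (w : List Bool) (i : ℕ) (h : i < w.length) :
    wordCell a w (a + i) = Sym.bit w[i] := by
  simp [wordCell, h]

theorem wordTape_eq_zero_iff (a : ℤ) (w : List Bool) : wordTape a w = 0 ↔ w = [] := by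
  constructor
  · intro h
    by_contra hw
    have hl := List.length_pos_of_ne_nil hw
    have h1 := (wordCell_ne_blank a w a).2 ⟨le_rfl, by omega⟩
    exact h1 (DFunLike.congr_fun h a)
  · rintro rfl
    ext z
    change wordCell a [] z = Sym.blank
    by_contra h
    have := (wordCell_ne_blank _ _ _).1 h
    simp at this
    omega

theorem wordTape_injective {a a' : ℤ} {w w' : List Bool} (h : wordTape a w = wordTape a' w') :
    w = w' ∧ (w ≠ [] → a = a') := by
  have hc : ∀ z, wordCell a w z = wordCell a' w' z := fun z => DFunLike.congr_fun h z
  have hi : ∀ z, (a ≤ z ∧ z < a + w.length) ↔ (a' ≤ z ∧ z < a' + w'.length) := by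
    intro z
    rw [← wordCell_ne_blank, hc, wordCell_ne_blank]
  by_cases hw : w = []
  · subst hw
    have h0 := (wordTape_eq_zero_iff a []).2 rfl
    rw [h0, eq_comm, wordTape_eq_zero_iff] at h
    simp [h]
  have hl := List.length_pos_of_ne_nil hw
  have h1 := (hi a).1 ⟨le_rfl, by omega⟩
  have h2 := (hi a').2 ⟨le_rfl, by omega⟩
  have haa : a = a' := by omega
  subst haa
  have h3 := (hi (a + w.length - 1)).1 ⟨by omega, by omega⟩
  have h4 := (hi (a + w'.length - 1)).2 ⟨by omega, by omega⟩
  refine ⟨List.ext_getElem (by omega) fun i hi1 hi2 => ?_, fun _ => rfl⟩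
  have := hc (a + i)
  rw [wordCell_add _ _ _ hi1, wordCell_add _ _ _ hi2] at this
  exact Sym.bit.inj this

theorem Holds.unique {t : Tape} {w w' : List Bool} (h : Holds t w) (h' : Holds t w') : w = w' := by
  obtain ⟨a, rfl⟩ := h
  obtain ⟨a', h'⟩ := h'
  exact (wordTape_injective h').1

theorem wordTape_concat_injective {a a' : ℤ} {w w' : List Bool} {b b' : Bool}
    (h : wordTape a (w ++ [b]) = wordTape a' (w' ++ [b'])) : a = a' ∧ w = w' ∧ b = b' := by
  obtain ⟨h1, h2⟩ := wordTape_injective h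
  have h3 := List.append_inj' h1 rfl
  exact ⟨h2 (by simp), h3.1, by simpa using h3.2⟩

/-- The choice hidden in `callTape` is harmless, since a nonempty block determines its position and
its word. -/
theorem callTape_wordTape (A : Oracle) (a : ℤ) (x : List Bool) (b : Bool) :
    callTape A (wordTape a (x ++ [b])) = wordTape a (x ++ [xor b (A x)]) := by
  have h : ∃ q : ℤ × List Bool × Bool,
      wordTape a (x ++ [b]) = wordTape q.1 (q.2.1 ++ [q.2.2]) := ⟨(a, x, b), rfl⟩
  rw [callTape, dif_pos h]
  obtain ⟨h1, h2, h3⟩ := wordTape_concat_injective h.choose_spec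
  rw [← h1, ← h2, ← h3]

theorem callTape_of_forall_ne (A : Oracle) (t : Tape)
    (h : ∀ a x b, t ≠ wordTape a (x ++ [b])) : callTape A t = t := by
  rw [callTape, dif_neg]
  rintro ⟨q, hq⟩
  exact h _ _ _ hq

end OracleTM

namespace OracleTM

variable {F : Frame}

/-! ### Weights of superpositions -/

open Classical in
theorem weight_eq_sum (φ : Superposition F) (P : Config F → Prop) {s : Finset (Config F)}
    (hs : φ.support ⊆ s) : weight φ P = ∑ c ∈ s, if P c then ‖φ c‖ ^ 2 else 0 := by
  unfold weight
  exact Finsupp.sum_of_support_subset φ hs _ (by simp)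

theorem weight_nonneg (φ : Superposition F) (P : Config F → Prop) : 0 ≤ weight φ P := by
  classical
  rw [weight_eq_sum φ P subset_rfl]
  refine Finset.sum_nonneg fun c _ => ?_
  split_ifs <;> positivity

theorem weight_mono_support (φ : Superposition F) {P Q : Config F → Prop}
    (h : ∀ c ∈ φ.support, P c → Q c) : weight φ P ≤ weight φ Q := by
  classical
  rw [weight_eq_sum φ P subset_rfl, weight_eq_sum φ Q subset_rfl]
  refine Finset.sum_le_sum fun c hc => ?_
  by_cases hP : P c
  · simp [hP, h c hc hP]
  · rw [if_neg hP]
    split_ifs <;> positivity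

theorem weight_mono (φ : Superposition F) {P Q : Config F → Prop} (h : ∀ c, P c → Q c) :
    weight φ P ≤ weight φ Q :=
  weight_mono_support φ fun c _ => h c

theorem weight_single (c : Config F) (z : ℂ) : weight (Finsupp.single c z) (fun _ => True) = ‖z‖ ^ 2 := by
  classical
  unfold weight
  rw [Finsupp.sum_single_index] <;> simp

/-- Pairwise exclusive events have total weight at most that of the certain event. -/
theorem sum_weight_le {ι : Type*} (s : Finset ι) (φ : Superposition F) (P : ι → Config F → Prop)
    (h : ∀ c, ∀ i ∈ s, ∀ j ∈ s, P i c → P j c → i = j) :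
    ∑ i ∈ s, weight φ (P i) ≤ weight φ (fun _ => True) := by
  classical
  rw [weight_eq_sum φ _ subset_rfl]
  simp only [weight_eq_sum φ _ subset_rfl]
  rw [Finset.sum_comm]
  refine Finset.sum_le_sum fun c _ => ?_
  rw [if_pos trivial]
  by_cases he : ∃ i ∈ s, P i c
  · obtain ⟨i, hi, hP⟩ := he
    rw [Finset.sum_eq_single_of_mem i hi, if_pos hP]
    intro j hj hji
    rw [if_neg]
    exact fun hPj => hji (h c j hj i hi hPj hP)
  · rw [Finset.sum_eq_zero]
    · positivity
    · intro i hi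
      rw [if_neg]
      exact fun hP => he ⟨i, hi, hP⟩

theorem weight_or_le (φ : Superposition F) (P Q : Config F → Prop) :
    weight φ (fun c => P c ∨ Q c) ≤ weight φ P + weight φ Q := by
  classical
  simp only [weight_eq_sum φ _ subset_rfl]
  rw [← Finset.sum_add_distrib]
  refine Finset.sum_le_sum fun c _ => ?_
  have := sq_nonneg ‖φ c‖
  by_cases hP : P c <;> by_cases hQ : Q c <;> simp [hP, hQ]

/-- Pointwise this is `(a + b) ^ 2 ≤ 3 / 2 * a ^ 2 + 3 * b ^ 2`, that is, `(a - 2 * b) ^ 2 ≥ 0`. The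
factor `3 / 2` is small enough to separate probability `2 / 3` from `1 / 3`. -/
theorem weight_le_add (φ ψ : Superposition F) (P : Config F → Prop) :
    weight φ P ≤ 3 / 2 * weight ψ P + 3 * weight (φ - ψ) (fun _ => True) := by
  classical
  set s := φ.support ∪ ψ.support ∪ (φ - ψ).support
  rw [weight_eq_sum φ P (s := s) (by intro c; simp only [s, Finset.mem_union]; tauto),
    weight_eq_sum ψ P (s := s) (by intro c; simp only [s, Finset.mem_union]; tauto),
    weight_eq_sum (φ - ψ) _ (s := s) (by intro c; simp only [s, Finset.mem_union]; tauto),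
    Finset.mul_sum, Finset.mul_sum, ← Finset.sum_add_distrib]
  refine Finset.sum_le_sum fun c _ => ?_
  have h1 : ‖φ c‖ ≤ ‖ψ c‖ + ‖(φ - ψ) c‖ := by
    have := norm_add_le (ψ c) ((φ - ψ) c)
    simpa using this
  have h2 := norm_nonneg (φ c)
  by_cases hP : P c
  · simp only [hP, if_true]
    nlinarith [sq_nonneg (‖ψ c‖ - 2 * ‖(φ - ψ) c‖)]
  · simp only [hP, if_false, if_true]
    positivity

theorem weight_sum_le {ι : Type*} (t : Finset ι) (φ : ι → Superposition F) (P : Config F → Prop) :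
    weight (∑ i ∈ t, φ i) P ≤ t.card * ∑ i ∈ t, weight (φ i) P := by
  classical
  set s := (∑ i ∈ t, φ i).support ∪ t.biUnion fun i => (φ i).support
  have hs : ∀ i ∈ t, (φ i).support ⊆ s := fun i hi =>
    (Finset.subset_biUnion_of_mem (fun i => (φ i).support) hi).trans Finset.subset_union_right
  rw [weight_eq_sum _ P (s := s) Finset.subset_union_left,
    Finset.sum_congr rfl fun i hi => weight_eq_sum (φ i) P (hs i hi), Finset.sum_comm,
    Finset.mul_sum]
  refine Finset.sum_le_sum fun c _ => ?_
  by_cases hP : P c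
  · simp only [hP, if_true, Finsupp.coe_finsetSum, Finset.sum_apply]
    calc ‖∑ i ∈ t, φ i c‖ ^ 2 ≤ (∑ i ∈ t, ‖φ i c‖) ^ 2 := by
          gcongr
          exact norm_sum_le _ _
      _ ≤ _ := sq_sum_le_card_mul_sum_sq
  · simp [hP]

theorem weight_sub_le (φ ψ : Superposition F) :
    weight (φ - ψ) (fun _ => True) ≤
      2 * (weight φ (fun _ => True) + weight ψ (fun _ => True)) := by
  classical
  set s := φ.support ∪ ψ.support ∪ (φ - ψ).support
  rw [weight_eq_sum φ _ (s := s) (by intro c; simp only [s, Finset.mem_union]; tauto),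
    weight_eq_sum ψ _ (s := s) (by intro c; simp only [s, Finset.mem_union]; tauto),
    weight_eq_sum (φ - ψ) _ (s := s) (by intro c; simp only [s, Finset.mem_union]; tauto),
    ← Finset.sum_add_distrib, Finset.mul_sum]
  refine Finset.sum_le_sum fun c _ => ?_
  have h1 : ‖(φ - ψ) c‖ ≤ ‖φ c‖ + ‖ψ c‖ := norm_sub_le (φ c) (ψ c)
  have h2 := norm_nonneg ((φ - ψ) c)
  simp only [if_true]
  nlinarith [sq_nonneg (‖φ c‖ - ‖ψ c‖)]

theorem weight_filter (φ : Superposition F) (P : Config F → Prop) [DecidablePred P] :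
    weight (φ.filter P) (fun _ => True) = weight φ P := by
  classical
  rw [weight_eq_sum φ P subset_rfl,
    weight_eq_sum (φ.filter P) _ (s := φ.support) (by simp [Finsupp.support_filter])]
  refine Finset.sum_congr rfl fun c _ => ?_
  by_cases hP : P c <;> simp [hP]

/-! ### The hybrid argument -/

/-- The configuration is about to query a word for which `p` holds. -/
def Config.Queries (c : Config F) (p : List Bool → Prop) : Prop :=
  c.state = F.query ∧ ∃ a w b, c.tape 1 = wordTape a (w ++ [b]) ∧ p w

theorem Config.call_eq_of_not_queries {A H : Oracle} {c : Config F} (hq : c.state = F.query)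
    (h : ¬ c.Queries fun w => A w ≠ H w) : c.call A = c.call H := by
  have : callTape A (c.tape 1) = callTape H (c.tape 1) := by
    by_cases ht : ∃ a x b, c.tape 1 = wordTape a (x ++ [b])
    · obtain ⟨a, x, b, ht⟩ := ht
      rw [ht, callTape_wordTape, callTape_wordTape]
      have : A x = H x := by
        by_contra hne
        exact h ⟨hq, a, x, b, ht, hne⟩
      rw [this]
    · push Not at ht
      rw [callTape_of_forall_ne _ _ ht, callTape_of_forall_ne _ _ ht]
  simp only [Config.call, this]

namespace QuantumMachine

variable (M : QuantumMachine)

theorem stepConfig_eq_of_not_queries {A H : Oracle} {c : Config M.toFrame}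
    (h : ¬ c.Queries fun w => A w ≠ H w) : M.stepConfig A c = M.stepConfig H c := by
  unfold stepConfig
  split_ifs with hq
  · rw [Config.call_eq_of_not_queries hq h]
  · rfl

variable {M}

theorem WellFormed.weight_iterate (hM : M.WellFormed) (A : Oracle) (φ : Superposition M.toFrame)
    (k : ℕ) : weight ((M.evolve A)^[k] φ) (fun _ => True) = weight φ (fun _ => True) := by
  induction k with
  | zero => rfl
  | succ k ih => rw [Function.iterate_succ_apply', hM, ih]

theorem WellFormed.weight_run (hM : M.WellFormed) (A : Oracle) (x : List Bool) (t : ℕ) :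
    weight (M.run A x t) (fun _ => True) = 1 := by
  rw [run, hM.weight_iterate, weight_single]
  simp

/-- Configurations that do not query a point of disagreement evolve identically and cancel. On the
rest, each of the two evolutions preserves the norm, and `weight_sub_le` gives `2 * (1 + 1) = 4`. -/
theorem WellFormed.weight_evolve_sub_le (hM : M.WellFormed) (A H : Oracle)
    (φ : Superposition M.toFrame) :
    weight (M.evolve A φ - M.evolve H φ) (fun _ => True) ≤
      4 * weight φ (fun c => c.Queries fun w => A w ≠ H w) := by
  classical
  set D : Config M.toFrame → Prop := fun c => c.Queries fun w => A w ≠ H w with hD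
  have h1 : M.evolve A (φ.filter fun c => ¬ D c) = M.evolve H (φ.filter fun c => ¬ D c) := by
    simp only [evolve, Finsupp.linearCombination_apply]
    refine Finsupp.sum_congr fun c hc => ?_
    rw [Finsupp.support_filter, Finset.mem_filter] at hc
    rw [stepConfig_eq_of_not_queries M hc.2]
  have h2 : M.evolve A φ - M.evolve H φ = M.evolve A (φ.filter D) - M.evolve H (φ.filter D) := by
    conv_lhs => rw [← Finsupp.filter_add_filter_not φ D]
    rw [map_add, map_add, h1, add_sub_add_right_eq_sub]
  rw [h2]
  refine (weight_sub_le _ _).trans (le_of_eq ?_)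
  rw [hM, hM, weight_filter]
  ring

theorem run_succ (A : Oracle) (x : List Bool) (t : ℕ) :
    M.run A x (t + 1) = M.evolve A (M.run A x t) := by
  rw [run, Function.iterate_succ_apply']
  rfl

/-- Telescoping over hybrids that use `A` for the first steps and `H` for the others. Every summand
starts from the run with `A`, so query weights are needed for that run only, never for the run with
`H`. -/
theorem run_sub_run (A H : Oracle) (x : List Bool) (t : ℕ) :
    M.run A x t - M.run H x t = ∑ s ∈ Finset.range t, (M.evolve H)^[t - 1 - s]
      (M.evolve A (M.run A x s) - M.evolve H (M.run A x s)) := by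
  induction t with
  | zero => simp [run]
  | succ t ih =>
    rw [Finset.sum_range_succ]
    have : ∀ s ∈ Finset.range t, (M.evolve H)^[t + 1 - 1 - s]
        (M.evolve A (M.run A x s) - M.evolve H (M.run A x s)) =
        M.evolve H ((M.evolve H)^[t - 1 - s]
          (M.evolve A (M.run A x s) - M.evolve H (M.run A x s))) := by
      intro s hs
      rw [Finset.mem_range] at hs
      rw [← Function.iterate_succ_apply' (M.evolve H)]
      congr 2
      omega
    rw [Finset.sum_congr rfl this, ← map_sum, ← ih, run_succ, run_succ, map_sub]
    simp

/-- The total weight, over the first `t` steps, of the queries for which `p` holds. -/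
noncomputable def queryWeight (M : QuantumMachine) (A : Oracle) (x : List Bool) (t : ℕ)
    (p : List Bool → Prop) : ℝ :=
  ∑ s ∈ Finset.range t, weight (M.run A x s) fun c => c.Queries p

theorem queryWeight_mono (A : Oracle) (x : List Bool) {s t : ℕ} (hst : s ≤ t)
    {p q : List Bool → Prop} (h : ∀ w, p w → q w) :
    M.queryWeight A x s p ≤ M.queryWeight A x t q := by
  refine (Finset.sum_le_sum fun i _ => weight_mono _ (Q := fun c => c.Queries q) ?_).trans
    (Finset.sum_le_sum_of_subset_of_nonneg (Finset.range_mono hst)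
      fun i _ _ => weight_nonneg _ _)
  rintro c ⟨h1, a, w, b, h2, h3⟩
  exact ⟨h1, a, w, b, h2, h w h3⟩

theorem queryWeight_or_le (A : Oracle) (x : List Bool) (t : ℕ) (p q : List Bool → Prop) :
    M.queryWeight A x t (fun w => p w ∨ q w) ≤ M.queryWeight A x t p + M.queryWeight A x t q := by
  unfold queryWeight
  rw [← Finset.sum_add_distrib]
  refine Finset.sum_le_sum fun i _ => (weight_mono _ ?_).trans (weight_or_le _ _ _)
  rintro c ⟨h1, a, w, b, h2, h3 | h3⟩
  · exact Or.inl ⟨h1, a, w, b, h2, h3⟩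
  · exact Or.inr ⟨h1, a, w, b, h2, h3⟩

/-- At each time the superposition has weight `1`, and a configuration queries at most one word, so
it counts for at most one index. -/
theorem WellFormed.sum_queryWeight_le (hM : M.WellFormed) {ι : Type*} (s : Finset ι) (A : Oracle)
    (x : List Bool) (t : ℕ) (p : ι → List Bool → Prop)
    (hp : ∀ w, ∀ i ∈ s, ∀ j ∈ s, p i w → p j w → i = j) :
    ∑ i ∈ s, M.queryWeight A x t (p i) ≤ t := by
  unfold queryWeight
  rw [Finset.sum_comm]
  calc _ ≤ ∑ _k ∈ Finset.range t, (1 : ℝ) := by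
        refine Finset.sum_le_sum fun k _ => ?_
        rw [← hM.weight_run A x k]
        refine sum_weight_le s _ _ ?_
        rintro c i hi j hj ⟨-, a, w, b, h2, h3⟩ ⟨-, a', w', b', h2', h3'⟩
        rw [h2] at h2'
        obtain ⟨-, rfl, -⟩ := wordTape_concat_injective h2'
        exact hp w i hi j hj h3 h3'
    _ = t := by simp

theorem WellFormed.weight_run_sub_run_le (hM : M.WellFormed) (A H : Oracle) (x : List Bool)
    (t : ℕ) : weight (M.run A x t - M.run H x t) (fun _ => True) ≤
      4 * t * M.queryWeight A x t fun w => A w ≠ H w := by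
  rw [run_sub_run, mul_comm (4 : ℝ) t, mul_assoc]
  refine (weight_sum_le _ _ _).trans ?_
  rw [Finset.card_range, queryWeight, Finset.mul_sum (a := (4 : ℝ))]
  refine mul_le_mul_of_nonneg_left (Finset.sum_le_sum fun s _ => ?_) t.cast_nonneg
  rw [hM.weight_iterate]
  exact hM.weight_evolve_sub_le A H _

/-! ### Different answers force many queries. -/

/-- With oracle `A`, on input `y`, the machine halts within `τ` steps and its output is then `x`
with probability at least `2 / 3`. -/
def Finds (M : QuantumMachine) (A : Oracle) (y x : List Bool) (τ : ℕ) : Prop :=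
  ∃ t ≤ τ, M.HaltsAt A y t ∧ 2 / 3 ≤ weight (M.run A y t) (fun c => c.Outputs x)

theorem WellFormed.weight_eq_one (hM : M.WellFormed) {A : Oracle} {y : List Bool} {t : ℕ}
    (h : M.HaltsAt A y t) : weight (M.run A y t) (fun c => c.state = M.final) = 1 := by
  refine le_antisymm ?_ ?_
  · rw [← hM.weight_run A y t]
    exact weight_mono _ fun _ _ => trivial
  · rw [← hM.weight_run A y t]
    exact weight_mono_support _ fun c hc _ => h.1 c hc

theorem weight_eq_zero {A : Oracle} {y : List Bool} {s t : ℕ} (h : M.HaltsAt A y t) (hs : s < t) :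
    weight (M.run A y s) (fun c => c.state = M.final) = 0 := by
  classical
  rw [weight_eq_sum _ _ subset_rfl]
  exact Finset.sum_eq_zero fun c hc => if_neg (h.2 s hs c hc)

/-- The superpositions must be far apart at the earlier of the two halting times. If the times
differ, one superposition is then entirely final and the other not at all; if they agree, the output
distributions differ. -/
theorem WellFormed.exists_distinguishing (hM : M.WellFormed) {A A' : Oracle} {y x x' : List Bool}
    {τ : ℕ} (h : M.Finds A y x τ) (h' : M.Finds A' y x' τ) (hx : x ≠ x') :
    ∃ s ≤ τ, 1 / 18 ≤ weight (M.run A y s - M.run A' y s) (fun _ => True) := by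
  obtain ⟨t, ht, hh, hw⟩ := h
  obtain ⟨t', ht', hh', hw'⟩ := h'
  rcases lt_trichotomy t t' with hlt | rfl | hlt
  · refine ⟨t, ht, ?_⟩
    have := weight_le_add (M.run A y t) (M.run A' y t) (fun c => c.state = M.final)
    rw [hM.weight_eq_one hh, weight_eq_zero hh' hlt] at this
    linarith
  -- The outputs `x` and `x'` exclude each other, so with `A'` the word `x` has probability at most
  -- `1 / 3`. Then `2 / 3 ≤ 3 / 2 * (1 / 3) + 3 * d`, whence `d ≥ 1 / 18`.
  · refine ⟨t, ht, ?_⟩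
    have h1 := weight_le_add (M.run A y t) (M.run A' y t) (fun c => c.Outputs x)
    have h2 := sum_weight_le (Finset.univ : Finset Bool) (M.run A' y t)
      (fun b c => c.Outputs (if b then x else x')) (by
        intro c i _ j _ hi hj
        have := hi.unique hj
        cases i <;> cases j <;> simp_all)
    rw [hM.weight_run] at h2
    simp only [Fintype.univ_bool, Finset.mem_singleton, Bool.true_eq_false, not_false_eq_true,
      Finset.sum_insert, if_true, Finset.sum_singleton, Bool.false_eq_true, if_false] at h2
    linarith
  · refine ⟨t', ht', ?_⟩
    have := weight_le_add (M.run A y t') (M.run A' y t') (fun c => c.state ≠ M.final)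
    have h1 : weight (M.run A y t') (fun c => c.state ≠ M.final) = 1 := by
      refine le_antisymm ?_ ?_
      · rw [← hM.weight_run A y t']
        exact weight_mono _ fun _ _ => trivial
      · rw [← hM.weight_run A y t']
        exact weight_mono_support _ fun c hc _ => hh.2 t' hlt c hc
    have h2 : weight (M.run A' y t') (fun c => c.state ≠ M.final) = 0 := by
      classical
      rw [weight_eq_sum _ _ subset_rfl]
      exact Finset.sum_eq_zero fun c hc => if_neg (not_not.2 (hh'.1 c hc))
    rw [h1, h2] at this
    linarith

/-- If a machine finds different words with the oracles `A` and `A'`, then it makes, with one of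
them, many queries in the set where that oracle differs from a third one. -/
theorem WellFormed.le_queryWeight (hM : M.WellFormed) {A A' : Oracle} (H : Oracle)
    {y x x' : List Bool} {τ : ℕ} (h : M.Finds A y x τ) (h' : M.Finds A' y x' τ) (hx : x ≠ x') :
    1 / 144 ≤ τ * (M.queryWeight A y τ (fun w => A w ≠ H w) +
      M.queryWeight A' y τ fun w => A' w ≠ H w) := by
  obtain ⟨s, hs, hw⟩ := hM.exists_distinguishing h h' hx
  -- Both runs are compared with the run on `H`: the factors `2` here and `4` from the hybrid bound
  -- turn `1 / 18` into `1 / 144`.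
  have h1 := weight_sub_le (M.run A y s - M.run H y s) (M.run A' y s - M.run H y s)
  rw [sub_sub_sub_cancel_right] at h1
  have h2 := hM.weight_run_sub_run_le A H y s
  have h3 := hM.weight_run_sub_run_le A' H y s
  have nn : ∀ (A : Oracle) p, 0 ≤ M.queryWeight A y s p := fun A p =>
    Finset.sum_nonneg fun _ _ => weight_nonneg _ _
  have h4 : s * (M.queryWeight A y s (fun w => A w ≠ H w) +
      M.queryWeight A' y s fun w => A' w ≠ H w) ≤
      τ * (M.queryWeight A y τ (fun w => A w ≠ H w) +
      M.queryWeight A' y τ fun w => A' w ≠ H w) := by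
    have hs' : (s : ℝ) ≤ τ := by exact_mod_cast hs
    have := nn A fun w => A w ≠ H w
    have := nn A' fun w => A' w ≠ H w
    gcongr
    · exact queryWeight_mono _ _ hs fun _ => id
    · exact queryWeight_mono _ _ hs fun _ => id
  linarith

end QuantumMachine

end OracleTM

namespace OracleTM

/-! ### Oracles that differ at one length -/

/-- The word `x` coded by a pair `(x, i)`. -/
def decode (w : List Bool) : List Bool := (w.dropWhile id).tail

theorem Permutations.oracle_eq {π π' : Permutations} {w : List Bool}
    (h : π.toFun (decode w) = π'.toFun (decode w)) : π.oracle w = π'.oracle w := by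
  simp only [decode] at h
  simp only [Permutations.oracle, h]

theorem Permutations.toFun_of_length (π : Permutations) {n : ℕ} (v : List Bool)
    (h : v.length = n) : π.toFun v = List.ofFn (π n fun i => v.get (i.cast h.symm)) := by
  subst h
  rfl

theorem Permutations.toFun_ofFn (π : Permutations) {n : ℕ} (x : Fin n → Bool) :
    π.toFun (List.ofFn x) = List.ofFn (π n x) := by
  rw [π.toFun_of_length _ (List.length_ofFn (f := x))]
  congr 2
  ext i
  simp

theorem Permutations.toFun_congr {π π' : Permutations} {v : List Bool}
    (h : π v.length = π' v.length) : π.toFun v = π'.toFun v := by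
  simp only [Permutations.toFun, h]

theorem ofFn_get_cast {n : ℕ} (v : List Bool) (h : v.length = n) :
    List.ofFn (fun i : Fin n => v.get (i.cast h.symm)) = v := by
  subst h
  simp

theorem Permutations.oracle_update_eq (π : Permutations) {n : ℕ}
    {σ σ' : Equiv.Perm (Fin n → Bool)} {w : List Bool}
    (h : ∀ x, decode w = List.ofFn x → σ x = σ' x) :
    (Permutations.oracle (Function.update π n σ)) w =
      Permutations.oracle (Function.update π n σ') w := by
  apply Permutations.oracle_eq
  by_cases hn : (decode w).length = n
  · rw [Permutations.toFun_of_length _ _ hn, Permutations.toFun_of_length _ _ hn,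
      Function.update_self, Function.update_self, h]
    exact (ofFn_get_cast _ hn).symm
  · apply Permutations.toFun_congr
    rw [Function.update_of_ne hn, Function.update_of_ne hn]

open Classical in
/-- Whatever the permutations at the other lengths, a machine inverts only few of the permutations
of length `n`, at a given place. -/
theorem QuantumMachine.WellFormed.card_finds_le {M : QuantumMachine} (hM : M.WellFormed)
    (π : Permutations) (n : ℕ) (y : Fin n → Bool) (τ : ℕ) :
    (Finset.univ.filter fun σ : Equiv.Perm (Fin n → Bool) =>
      M.Finds (Permutations.oracle (Function.update π n σ)) (List.ofFn y)
        (List.ofFn (σ.symm y)) τ).card ^ 2 * 2 ^ n ≤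
      Fintype.card (Equiv.Perm (Fin n → Bool)) ^ 2 * (3 * (432 * τ ^ 2) + 1) := by
  set A : Equiv.Perm (Fin n → Bool) → Oracle := fun σ =>
    Permutations.oracle (Function.update π n σ) with hA
  set Q : Equiv.Perm (Fin n → Bool) → (Fin n → Bool) → ℝ := fun σ x =>
    M.queryWeight (A σ) (List.ofFn y) τ (fun w => decode w = List.ofFn x) with hQ
  have hX : Fintype.card (Fin n → Bool) = 2 ^ n := by simp
  rw [← hX]
  -- The small set consists of the heavily queried points. The threshold is a third of `1 / 144`, as
  -- three points share the query weight; total weight at most `τ` leaves at most `432 * τ ^ 2` such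
  -- points.
  refine card_sq_mul_card_le y _ (fun σ => Finset.univ.filter fun x => 1 / 432 ≤ τ * Q σ x) _ ?_ ?_
  · intro σ
    have h1 : ∑ x, Q σ x ≤ τ := hM.sum_queryWeight_le _ _ _ _ _ (by
      intro w i _ j _ hi hj
      exact List.ofFn_injective (hi.symm.trans hj))
    have hQ0 : ∀ x, 0 ≤ Q σ x := fun x => Finset.sum_nonneg fun _ _ => weight_nonneg _ _
    have h2 : ((Finset.univ.filter fun x => 1 / 432 ≤ τ * Q σ x).card : ℝ) * (1 / 432) ≤
        τ * τ := by
      rw [← nsmul_eq_mul]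
      refine (Finset.card_nsmul_le_sum _ (fun x => τ * Q σ x) _ ?_).trans ?_
      · intro x hx
        exact (Finset.mem_filter.1 hx).2
      · rw [← Finset.mul_sum]
        refine mul_le_mul_of_nonneg_left (le_trans ?_ h1) (by positivity)
        exact Finset.sum_le_sum_of_subset_of_nonneg (Finset.subset_univ _) fun x _ _ => hQ0 x
    have h3 : ((Finset.univ.filter fun x => 1 / 432 ≤ τ * Q σ x).card : ℝ) ≤ 432 * τ ^ 2 := by
      linarith
    exact_mod_cast h3
  · intro ρ hρ ρ' hρ' c huv heq
    simp only [Finset.mem_filter, Finset.mem_univ, true_and] at hρ hρ' ⊢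
    set u := ρ.symm y
    set v := ρ'.symm y
    -- The hybrid oracle sends both `u` and `v` to `y` and need not come from a permutation. It
    -- agrees with `A ρ` except at `v` and `c`, and with `A ρ'` except at `u`, so neither machine's
    -- own solution counts against it.
    have key := hM.le_queryWeight (fun w => if decode w = List.ofFn u then A ρ w else A ρ' w)
      hρ hρ' (fun h => huv (List.ofFn_injective h))
    have h1 : M.queryWeight (A ρ) (List.ofFn y) τ
        (fun w => A ρ w ≠ if decode w = List.ofFn u then A ρ w else A ρ' w) ≤ Q ρ v + Q ρ c := by
      refine le_trans (QuantumMachine.queryWeight_mono _ _ le_rfl ?_)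
        (QuantumMachine.queryWeight_or_le _ _ _ _ _)
      intro w hw
      split_ifs at hw with hu
      · exact absurd rfl hw
      · by_contra hvc
        push Not at hvc
        apply hw
        apply Permutations.oracle_update_eq
        intro x hx
        rw [hx] at hu hvc
        exact heq x (fun h => hu (by rw [h])) (fun h => hvc.1 (by rw [h]))
          (fun h => hvc.2 (by rw [h]))
    have h2 : M.queryWeight (A ρ') (List.ofFn y) τ
        (fun w => A ρ' w ≠ if decode w = List.ofFn u then A ρ w else A ρ' w) ≤ Q ρ' u := by
      refine QuantumMachine.queryWeight_mono _ _ le_rfl ?_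
      intro w hw
      split_ifs at hw with hu
      · exact hu
      · exact absurd rfl hw
    by_contra hcon
    push Not at hcon
    have h3 : (τ : ℝ) * (M.queryWeight (A ρ) (List.ofFn y) τ
        (fun w => A ρ w ≠ if decode w = List.ofFn u then A ρ w else A ρ' w) +
        M.queryWeight (A ρ') (List.ofFn y) τ
        (fun w => A ρ' w ≠ if decode w = List.ofFn u then A ρ w else A ρ' w)) ≤
        τ * (Q ρ v + Q ρ c + Q ρ' u) :=
      mul_le_mul_of_nonneg_left (add_le_add h1 h2) (by positivity)
    have := key.trans h3
    linarith [hcon.1, hcon.2.1, hcon.2.2]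

end OracleTM

namespace OracleTM

/-! ### Measurability -/

namespace QuantumMachine

variable {M : QuantumMachine}

/-- In finite time a machine consults only finitely many values of the oracle. -/
theorem eventually_run_eq {ι : Type*} {l : Filter ι} {A : ι → Oracle} {A₀ : Oracle}
    (h : ∀ w, ∀ᶠ i in l, A i w = A₀ w) (x : List Bool) (t : ℕ) :
    ∀ᶠ i in l, M.run (A i) x t = M.run A₀ x t := by
  induction t with
  | zero => simp only [run, Function.iterate_zero, id_eq, Filter.eventually_true]
  | succ t ih =>
    have h1 : ∀ c : Config M.toFrame, ∀ᶠ i in l, M.stepConfig (A i) c = M.stepConfig A₀ c := by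
      intro c
      by_cases hc : ∃ a w b, c.tape 1 = wordTape a (w ++ [b])
      · obtain ⟨a, w, b, hc⟩ := hc
        filter_upwards [h w] with i hi
        refine stepConfig_eq_of_not_queries M ?_
        rintro ⟨-, a', w', b', h2, h3⟩
        obtain ⟨-, rfl, -⟩ := wordTape_concat_injective (hc.symm.trans h2)
        exact h3 hi
      · refine Filter.Eventually.of_forall fun i => stepConfig_eq_of_not_queries M ?_
        rintro ⟨-, a', w', b', h2, -⟩
        exact hc ⟨a', w', b', h2⟩
    have h2 := (Filter.eventually_all_finset (M.run A₀ x t).support).2 fun c _ => h1 c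
    filter_upwards [ih, h2] with i hi h2
    rw [run_succ, run_succ, hi]
    simp only [evolve, Finsupp.linearCombination_apply]
    exact Finsupp.sum_congr fun c hc => by rw [h2 c hc]

/-- Halting and output at time `t` depend only on the superpositions up to time `t`. -/
theorem eventually_finds {ι : Type*} {l : Filter ι} {A : ι → Oracle} {A₀ : Oracle}
    (h : ∀ w, ∀ᶠ i in l, A i w = A₀ w) {y x : List Bool} {τ : ℕ} (hf : M.Finds A₀ y x τ) :
    ∀ᶠ i in l, M.Finds (A i) y x τ := by
  obtain ⟨t, ht, hh, hw⟩ := hf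
  have h1 := (Filter.eventually_all_finset (Finset.range (t + 1))).2
    fun s _ => eventually_run_eq (M := M) h y s
  filter_upwards [h1] with i hi
  have hi' : ∀ s ≤ t, M.run (A i) y s = M.run A₀ y s := fun s hs =>
    hi s (Finset.mem_range.2 (by omega))
  refine ⟨t, ht, ⟨?_, ?_⟩, ?_⟩
  · rw [hi' t le_rfl]
    exact hh.1
  · intro s hs
    rw [hi' s hs.le]
    exact hh.2 s hs
  · rw [hi' t le_rfl]
    exact hw

-- With discrete factors the event is open in the product topology, as it depends locally on
-- finitely many of the permutations; the Borel sets of this countable product are the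
-- product-measurable ones.
variable (M) in
theorem measurableSet_finds (n : ℕ) (y : Fin n → Bool) (τ : ℕ) :
    MeasurableSet {π : Permutations |
      M.Finds π.oracle (List.ofFn y) (List.ofFn ((π n).symm y)) τ} := by
  let _ : ∀ k : ℕ, TopologicalSpace (Equiv.Perm (Fin k → Bool)) := fun _ => ⊥
  have _ : ∀ k : ℕ, DiscreteTopology (Equiv.Perm (Fin k → Bool)) := fun _ => ⟨rfl⟩
  have _ : ∀ k : ℕ, BorelSpace (Equiv.Perm (Fin k → Bool)) := fun k =>
    ⟨(borel_eq_top_of_discrete).symm⟩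
  have hev : ∀ (π : Permutations) (k : ℕ), ∀ᶠ π' : Permutations in nhds π, π' k = π k := by
    intro π k
    have := (continuous_apply (A := fun k : ℕ => Equiv.Perm (Fin k → Bool)) k).continuousAt
      (x := π)
    exact this.eventually_mem (IsOpen.mem_nhds (isOpen_discrete {π k}) rfl)
  refine IsOpen.measurableSet (isOpen_iff_eventually.2 fun π hπ => ?_)
  have hor : ∀ w, ∀ᶠ π' : Permutations in nhds π, π'.oracle w = π.oracle w := by
    intro w
    filter_upwards [hev π (decode w).length] with π' h
    exact Permutations.oracle_eq (Permutations.toFun_congr h)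
  filter_upwards [eventually_finds hor hπ, hev π n] with π' h1 h2
  rw [h2]
  exact h1

end QuantumMachine

/-! ### Resampling one of the permutations -/

theorem uniform_map_mul_right (n : ℕ) (σ : Equiv.Perm (Fin n → Bool)) :
    ((PMF.uniformOfFintype (Equiv.Perm (Fin n → Bool))).toMeasure).map (fun ρ => ρ * σ) =
      (PMF.uniformOfFintype (Equiv.Perm (Fin n → Bool))).toMeasure := by
  classical
  refine Measure.ext_of_singleton fun ρ => ?_
  rw [Measure.map_apply measurable_from_top (MeasurableSet.of_discrete)]
  have : (fun ρ => ρ * σ) ⁻¹' {ρ} = {ρ * σ⁻¹} := by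
    ext ρ'
    simp [eq_mul_inv_iff_mul_eq]
  rw [this, PMF.toMeasure_apply_singleton _ _ (MeasurableSet.of_discrete),
    PMF.toMeasure_apply_singleton _ _ (MeasurableSet.of_discrete)]
  simp

instance : IsProbabilityMeasure randomPermutations := by
  unfold randomPermutations
  infer_instance

theorem measurePreserving_mul_at (n : ℕ) (σ : Equiv.Perm (Fin n → Bool)) :
    MeasurePreserving (fun π : Permutations => Function.update π n (π n * σ))
      randomPermutations randomPermutations := by
  classical
  set f : (k : ℕ) → Equiv.Perm (Fin k → Bool) → Equiv.Perm (Fin k → Bool) :=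
    Function.update (fun k ρ => ρ) n (fun ρ => ρ * σ) with hf
  have hfun : (fun π : Permutations => (Function.update π n (π n * σ) : Permutations)) =
      fun π k => f k (π k) := by
    funext π k
    by_cases hk : k = n
    · subst hk
      simp [hf]
    · simp [hf, Function.update_of_ne hk]
  have hm : ∀ k, Measurable (f k) := fun k => measurable_from_top
  rw [hfun]
  refine ⟨measurable_pi_lambda _ fun k => (hm k).comp (measurable_pi_apply k), ?_⟩
  rw [randomPermutations, Measure.infinitePi_map_pi _ hm]
  congr 1
  funext k
  by_cases hk : k = n
  · subst hk
    simp only [hf, Function.update_self]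
    exact uniform_map_mul_right k σ
  · simp only [hf, Function.update_of_ne hk]
    exact Measure.map_id

-- A Fubini argument without splitting the product: multiplying the `n`-th permutation by a fixed
-- `σ` preserves the law, so the measure of `E` is an average over all `σ`, and for fixed `π` that
-- average is a count.
open Classical in
theorem randomPermutations_le_of_card_le {E : Set Permutations} (hE : MeasurableSet E) (n : ℕ)
    (δ : ℝ) (h : ∀ π : Permutations,
      ((Finset.univ.filter fun σ : Equiv.Perm (Fin n → Bool) =>
        (Function.update π n σ : Permutations) ∈ E).card : ℝ) ≤
      δ * Fintype.card (Equiv.Perm (Fin n → Bool))) :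
    randomPermutations E ≤ ENNReal.ofReal δ := by
  set P := Fintype.card (Equiv.Perm (Fin n → Bool)) with hP
  have hP0 : 0 < P := Fintype.card_pos
  set T : Equiv.Perm (Fin n → Bool) → Permutations → Permutations :=
    fun σ π => Function.update π n (π n * σ) with hT
  have h1 : ∀ σ, randomPermutations E = ∫⁻ π, E.indicator 1 (T σ π) ∂randomPermutations := by
    intro σ
    rw [(measurePreserving_mul_at n σ).lintegral_comp (measurable_one.indicator hE),
      lintegral_indicator_one hE]
  have hmeas : ∀ σ, Measurable fun π => E.indicator (1 : Permutations → ENNReal) (T σ π) :=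
    fun σ => (measurable_one.indicator hE).comp (measurePreserving_mul_at n σ).measurable
  have h2 : (P : ENNReal) * randomPermutations E ≤ ENNReal.ofReal (δ * P) := by
    calc (P : ENNReal) * randomPermutations E
        = ∑ σ : Equiv.Perm (Fin n → Bool),
            ∫⁻ π, E.indicator 1 (T σ π) ∂randomPermutations := by
          rw [← Finset.sum_congr rfl fun σ _ => h1 σ]
          simp [hP]
      _ = ∫⁻ π, ∑ σ : Equiv.Perm (Fin n → Bool), E.indicator 1 (T σ π) ∂randomPermutations :=
          (lintegral_finsetSum _ fun σ _ => hmeas σ).symm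
      _ ≤ ∫⁻ _π, ENNReal.ofReal (δ * P) ∂randomPermutations := by
          refine lintegral_mono fun π => ?_
          -- As `σ` runs through the group, so does `π n * σ`.
          have e : ∑ σ : Equiv.Perm (Fin n → Bool), E.indicator (1 : Permutations → ENNReal) (T σ π)
              = ∑ σ : Equiv.Perm (Fin n → Bool),
                E.indicator 1 (Function.update π n σ : Permutations) :=
            Fintype.sum_equiv (Equiv.mulLeft (π n)) _ _ fun σ => rfl
          dsimp only
          rw [e]
          simp only [Set.indicator_apply, Pi.one_apply]
          rw [Finset.sum_boole, ← ENNReal.ofReal_natCast]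
          exact ENNReal.ofReal_le_ofReal (h π)
      _ = ENNReal.ofReal (δ * P) := by simp
  rw [mul_comm δ, ENNReal.ofReal_mul (by positivity), ENNReal.ofReal_natCast] at h2
  exact (ENNReal.mul_le_mul_iff_right (by positivity) (ENNReal.natCast_ne_top P)).1 h2

/-! ### The lower bound for one machine -/

theorem QuantumMachine.WellFormed.measure_finds_le {M : QuantumMachine} (hM : M.WellFormed)
    (n : ℕ) (y : Fin n → Bool) :
    randomPermutations {π : Permutations | M.Finds π.oracle (List.ofFn y)
      (List.ofFn ((π n).symm y)) ⌊(2 : ℝ) ^ ((n : ℝ) / 3)⌋₊} ≤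
      ENNReal.ofReal (37 * ((2 : ℝ) ^ (-(1 / 6) : ℝ)) ^ n) := by
  classical
  refine randomPermutations_le_of_card_le (M.measurableSet_finds n y _) n _ fun π => ?_
  set q := (2 : ℝ) ^ ((n : ℝ) / 3) with hq
  set r := ((2 : ℝ) ^ (-(1 / 6) : ℝ)) ^ n with hr
  set τ := ⌊q⌋₊
  have h := hM.card_finds_le π n y τ
  have hset : (Finset.univ.filter fun σ : Equiv.Perm (Fin n → Bool) =>
      (Function.update π n σ : Permutations) ∈ {π : Permutations | M.Finds π.oracle (List.ofFn y)
        (List.ofFn ((π n).symm y)) τ}) =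
      Finset.univ.filter fun σ : Equiv.Perm (Fin n → Bool) =>
        M.Finds (Permutations.oracle (Function.update π n σ)) (List.ofFn y)
          (List.ofFn (σ.symm y)) τ := by
    refine Finset.filter_congr fun σ _ => ?_
    change M.Finds _ _ (List.ofFn ((Function.update π n σ n).symm y)) _ ↔ _
    rw [Function.update_self]
  rw [hset]
  set C := (Finset.univ.filter fun σ : Equiv.Perm (Fin n → Bool) =>
        M.Finds (Permutations.oracle (Function.update π n σ)) (List.ofFn y)
          (List.ofFn (σ.symm y)) τ).card
  set P := Fintype.card (Equiv.Perm (Fin n → Bool))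
  have h' : (C : ℝ) ^ 2 * 2 ^ n ≤ P ^ 2 * (3 * (432 * τ ^ 2) + 1) := by exact_mod_cast h
  have hq0 : 0 < q := by positivity
  have hr0 : 0 < r := by positivity
  have hq1 : 1 ≤ q := Real.one_le_rpow (by norm_num) (by positivity)
  have hτ : (τ : ℝ) ≤ q := Nat.floor_le hq0.le
  have hq3 : q ^ 3 = 2 ^ n := by
    rw [hq, ← Real.rpow_natCast, ← Real.rpow_mul (by norm_num), ← Real.rpow_natCast]
    congr 1
    push_cast
    ring
  -- `r = 2 ^ (-n / 6)` is the inverse square root of `q = 2 ^ (n / 3)`.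
  have hrq : r ^ 2 * q = 1 := by
    rw [hr, hq, ← pow_mul, ← Real.rpow_natCast, ← Real.rpow_mul (by norm_num),
      ← Real.rpow_add (by norm_num)]
    have : -(1 / 6) * ((n * 2 : ℕ) : ℝ) + (n : ℝ) / 3 = 0 := by
      push_cast
      ring
    rw [this, Real.rpow_zero]
  have hτ2 : (τ : ℝ) ^ 2 ≤ q ^ 2 := by gcongr
  -- `3 * 432 + 1 = 1297`, rounded up to the square `1369 = 37 ^ 2`; the `1` is absorbed because `q
  -- ≥ 1`.
  have h1 : (C : ℝ) ^ 2 * q ^ 3 ≤ P ^ 2 * (1369 * q ^ 2) := by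
    rw [hq3]
    refine h'.trans ?_
    gcongr
    nlinarith
  have h2 : (C : ℝ) ^ 2 * q ≤ P ^ 2 * 1369 := by
    refine le_of_mul_le_mul_right ?_ (pow_pos hq0 2)
    linarith
  have h3 : (C : ℝ) ^ 2 ≤ (37 * r * P) ^ 2 := by
    calc (C : ℝ) ^ 2 = r ^ 2 * ((C : ℝ) ^ 2 * q) := by rw [mul_left_comm, hrq, mul_one]
      _ ≤ r ^ 2 * (P ^ 2 * 1369) := by gcongr
      _ = _ := by ring
  exact le_of_sq_le_sq h3 (by positivity)

/-- Almost surely, a given machine does not invert the random permutation in time `o(2 ^ (n/3))`. -/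
theorem QuantumMachine.WellFormed.ae_isBigO {M : QuantumMachine} (hM : M.WellFormed) :
    ∀ᵐ π ∂randomPermutations, ∀ T : ℕ → ℕ, M.InvertsInTime π.oracle π.toFun T →
      (fun n : ℕ => (2 : ℝ) ^ ((n : ℝ) / 3)) =O[Filter.atTop] (fun n : ℕ => (T n : ℝ)) := by
  -- One target per length suffices, here the zero word. The bad events do not mention `T`, so a
  -- single null set serves all time bounds.
  set y : (n : ℕ) → Fin n → Bool := fun n _ => false
  have hr1 : (2 : ℝ) ^ (-(1 / 6) : ℝ) < 1 :=
    Real.rpow_lt_one_of_one_lt_of_neg (by norm_num) (by norm_num)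
  have hsum : Summable fun n : ℕ => 37 * ((2 : ℝ) ^ (-(1 / 6) : ℝ)) ^ n :=
    (summable_geometric_of_lt_one (by positivity) hr1).mul_left _
  have hfin : ∑' n, randomPermutations {π : Permutations | M.Finds π.oracle (List.ofFn (y n))
      (List.ofFn ((π n).symm (y n))) ⌊(2 : ℝ) ^ ((n : ℝ) / 3)⌋₊} ≠ ⊤ :=
    ne_top_of_le_ne_top hsum.tsum_ofReal_ne_top
      (ENNReal.tsum_le_tsum fun n => hM.measure_finds_le n (y n))
  filter_upwards [ae_eventually_notMem hfin] with π hπ T hT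
  refine Asymptotics.IsBigO.of_bound 1 ?_
  filter_upwards [hπ] with n hn
  obtain ⟨t, ht, hh, hw⟩ := hT (List.ofFn ((π n).symm (y n)))
  rw [Permutations.toFun_ofFn, Equiv.apply_symm_apply] at ht hh hw
  rw [List.length_ofFn] at ht
  have hlt : (2 : ℝ) ^ ((n : ℝ) / 3) < t := by
    by_contra hcon
    push Not at hcon
    exact hn ⟨t, Nat.le_floor hcon, hh, hw⟩
  have : (t : ℝ) ≤ T n := by exact_mod_cast ht
  rw [Real.norm_of_nonneg (by positivity), Real.norm_of_nonneg (by positivity)]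
  linarith

/-! ### There are only countably many machines -/

instance : Countable Frame := by
  refine Function.Injective.countable (β := Σ s w : ℕ, Fin s × Fin s × Fin s × Fin s × Fin (w + 2))
    (f := fun F => ⟨F.states, F.work, F.start, F.final, F.query, F.answer, F.out⟩) ?_
  rintro ⟨⟩ ⟨⟩ h
  simp only [Sigma.mk.injEq] at h
  obtain ⟨rfl, h⟩ := h
  simp only [heq_eq_eq, Sigma.mk.injEq] at h
  obtain ⟨rfl, h⟩ := h
  simp only [heq_eq_eq, Prod.mk.injEq] at h
  simp [h]

instance : Countable DetMachine := by
  refine Function.Injective.countable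
    (β := Σ F : Frame, (Fin F.states → F.Scan → F.Action)) (f := fun M => ⟨M.toFrame, M.delta⟩) ?_
  rintro ⟨⟩ ⟨⟩ h
  simp only [Sigma.mk.injEq] at h
  obtain ⟨rfl, h⟩ := h
  simp only [heq_eq_eq] at h
  simp [h]

theorem DetMachine.HaltsAt.unique {M : DetMachine} {A : Oracle} {x : List Bool} {s t : ℕ}
    (hs : M.HaltsAt A x s) (ht : M.HaltsAt A x t) : s = t := by
  rcases lt_trichotomy s t with h | h | h
  · exact absurd hs.1 (ht.2 s h)
  · exact h
  · exact absurd ht.1 (hs.2 t h)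

theorem DetMachine.ComputesInTime.unique {M : DetMachine} {A : Oracle}
    {f g : List Bool → List Bool} {S T : ℕ → ℕ} (hf : M.ComputesInTime A f S)
    (hg : M.ComputesInTime A g T) : f = g := by
  funext x
  obtain ⟨s, -, hs, hfs⟩ := hf x
  obtain ⟨t, -, ht, hgt⟩ := hg x
  obtain rfl := hs.unique ht
  exact hfs.unique hgt

/-- A deterministic machine computes at most one function, and the approximations given by that
function determine the real number. So numbers inject into machines. -/
theorem countable_polyTimeReal : {r : ℝ | PolyTimeReal r}.Countable := by
  rw [← Set.countable_coe_iff]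
  choose M f p hM hf using fun r : {r : ℝ | PolyTimeReal r} => r.2
  refine Function.Injective.countable (f := M) fun r s hrs => ?_
  have hfg : f r = f s := by
    have h1 := hM r
    rw [hrs] at h1
    exact h1.unique (hM s)
  have hb : ∀ n : ℕ, |(r : ℝ) - s| ≤ 2 * (1 / 2 : ℝ) ^ n := by
    intro n
    have h1 := hf r n
    have h2 := hf s n
    rw [hfg] at h1
    rw [one_div_pow]
    rw [abs_sub_comm] at h2
    calc |(r : ℝ) - s| ≤ |(r : ℝ) - _| + |_ - (s : ℝ)| := abs_sub_le _ _ _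
      _ ≤ _ := add_le_add h1 h2
      _ = _ := by ring
  have hlim : Filter.Tendsto (fun n : ℕ => 2 * (1 / 2 : ℝ) ^ n) Filter.atTop (nhds 0) := by
    simpa using (tendsto_pow_atTop_nhds_zero_of_lt_one (r := (1 / 2 : ℝ)) (by norm_num)
      (by norm_num)).const_mul 2
  have := ge_of_tendsto' hlim hb
  exact Subtype.ext (sub_eq_zero.1 (abs_nonpos_iff.1 this))

theorem countable_amplitudes : Amplitudes.Countable := by
  have h := countable_polyTimeReal.prod countable_polyTimeReal
  refine (h.preimage (f := fun z : ℂ => (z.re, z.im)) ?_).mono ?_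
  · intro z w hzw
    simp only [Prod.mk.injEq] at hzw
    exact Complex.ext hzw.1 hzw.2
  · exact fun z hz => hz

instance : Countable QuantumMachine := by
  have _ : Countable Amplitudes := countable_amplitudes.to_subtype
  refine Function.Injective.countable
    (β := Σ F : Frame, (Fin F.states → F.Scan → F.Action → Amplitudes))
    (f := fun M => ⟨M.toFrame, fun q s a => ⟨M.amp q s a, M.amp_mem q s a⟩⟩) ?_
  rintro ⟨F, a, ha⟩ ⟨F', a', ha'⟩ h
  simp only [Sigma.mk.injEq] at h
  obtain ⟨rfl, h⟩ := h
  simp only [heq_eq_eq] at h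
  have : a = a' := by
    funext q s b
    have := congrFun (congrFun (congrFun h q) s) b
    exact congrArg Subtype.val this
  subst this
  rfl

theorem ae_forall_isBigO :
    ∀ᵐ π ∂randomPermutations, ∀ M : QuantumMachine, M.WellFormed →
      ∀ T : ℕ → ℕ, M.InvertsInTime π.oracle π.toFun T →
      (fun n : ℕ => (2 : ℝ) ^ ((n : ℝ) / 3)) =O[Filter.atTop] (fun n : ℕ => (T n : ℝ)) := by
  rw [ae_all_iff]
  intro M
  by_cases hM : M.WellFormed
  · filter_upwards [hM.ae_isBigO] with π hπ _
    exact hπ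
  · exact Filter.Eventually.of_forall fun π h => absurd h hM

/-! ### The function of a family of permutations. -/

theorem Permutations.length_toFun (π : Permutations) (x : List Bool) :
    (π.toFun x).length = x.length := by
  simp [Permutations.toFun]

theorem Permutations.bijective_toFun (π : Permutations) : Function.Bijective π.toFun := by
  refine ⟨fun x x' h => ?_, fun y => ?_⟩
  · have hl : x'.length = x.length := by
      rw [← π.length_toFun x, h, π.length_toFun]
    have h1 := π.toFun_of_length x rfl
    have h2 := π.toFun_of_length x' hl
    rw [h1, h2] at h
    have h3 := (π x.length).injective (List.ofFn_injective h)
    rw [← ofFn_get_cast x rfl, h3, ofFn_get_cast x' hl]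
  · refine ⟨List.ofFn ((π y.length).symm y.get), ?_⟩
    rw [π.toFun_ofFn]
    simp

end OracleTM

namespace OracleTM

/-! ### Writing at the ends of a word -/

theorem wordTape_nil (a : ℤ) : wordTape a [] = 0 := (wordTape_eq_zero_iff a []).2 rfl

theorem wordTape_add (a : ℤ) (w : List Bool) (i : ℕ) (h : i < w.length) :
    wordTape a w (a + i) = Sym.bit w[i] := wordCell_add a w i h

theorem wordTape_ne_blank (a : ℤ) (w : List Bool) (z : ℤ) :
    wordTape a w z ≠ Sym.blank ↔ a ≤ z ∧ z < a + w.length := wordCell_ne_blank a w z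

theorem wordTape_eq_blank {a : ℤ} {w : List Bool} {z : ℤ} (h : z < a ∨ a + w.length ≤ z) :
    wordTape a w z = Sym.blank := by
  by_contra hne
  have := (wordTape_ne_blank a w z).1 hne
  omega

theorem wordTape_concat (a : ℤ) (w : List Bool) (b : Bool) :
    (wordTape a w).update (a + w.length) (Sym.bit b) = wordTape a (w ++ [b]) := by
  ext z
  rw [Finsupp.update_apply]
  split_ifs with hz
  · subst hz
    rw [wordTape_add _ _ _ (by simp)]
    simp
  · by_cases hr : a ≤ z ∧ z < a + w.length
    · obtain ⟨i, rfl⟩ : ∃ i : ℕ, z = a + i := ⟨(z - a).toNat, by omega⟩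
      rw [wordTape_add _ _ _ (by omega),
        wordTape_add _ _ _ (by simp only [List.length_append]; omega), List.getElem_append_left]
    · rw [wordTape_eq_blank (by omega),
        wordTape_eq_blank (by simp only [List.length_append, List.length_singleton]; omega)]

theorem wordTape_overwrite (a : ℤ) (w : List Bool) (b b' : Bool) :
    (wordTape a (w ++ [b])).update (a + w.length) (Sym.bit b') = wordTape a (w ++ [b']) := by
  rw [← wordTape_concat, ← wordTape_concat]
  ext z
  simp only [Finsupp.update_apply]
  split_ifs <;> rfl

theorem wordTape_cons (a : ℤ) (w : List Bool) (b : Bool) :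
    (wordTape a w).update (a - 1) (Sym.bit b) = wordTape (a - 1) (b :: w) := by
  ext z
  rw [Finsupp.update_apply]
  split_ifs with hz
  · subst hz
    have := wordTape_add (a - 1) (b :: w) 0 (by simp)
    simpa using this.symm
  · by_cases hr : a ≤ z ∧ z < a + w.length
    · obtain ⟨i, rfl⟩ : ∃ i : ℕ, z = a + i := ⟨(z - a).toNat, by omega⟩
      have h1 : a + (i : ℤ) = a - 1 + ((i + 1 : ℕ) : ℤ) := by
        push_cast
        ring
      rw [wordTape_add _ _ _ (by omega), h1, wordTape_add _ _ _ (by simp; omega)]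
      simp
    · rw [wordTape_eq_blank (by omega),
        wordTape_eq_blank (by simp only [List.length_cons]; omega)]

/-! ### Deterministic runs -/

/-- From `c` the machine gets to `c'` in `k` steps, without being in the final state before. -/
def DetMachine.Reaches (M : DetMachine) (A : Oracle) (c : Config M.toFrame) (k : ℕ)
    (c' : Config M.toFrame) : Prop :=
  (M.step A)^[k] c = c' ∧ ∀ s < k, ((M.step A)^[s] c).state ≠ M.final

namespace DetMachine.Reaches

variable {M : DetMachine} {A : Oracle} {c c' c'' : Config M.toFrame} {k l : ℕ}

theorem refl (c : Config M.toFrame) : M.Reaches A c 0 c :=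
  ⟨rfl, fun _ hs => absurd hs (Nat.not_lt_zero _)⟩

theorem trans (h : M.Reaches A c k c') (h' : M.Reaches A c' l c'') :
    M.Reaches A c (k + l) c'' := by
  have hkl : ∀ s, (M.step A)^[k + s] c = (M.step A)^[s] c' := fun s => by
    rw [add_comm, Function.iterate_add_apply, h.1]
  refine ⟨by rw [hkl, h'.1], fun s hs => ?_⟩
  rcases lt_or_ge s k with hsk | hsk
  · exact h.2 s hsk
  · obtain ⟨r, rfl⟩ := Nat.exists_eq_add_of_le hsk
    rw [hkl]
    exact h'.2 r (by omega)

theorem single (hc : c.state ≠ M.final) (h : M.step A c = c') : M.Reaches A c 1 c' := by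
  refine ⟨h, fun s hs => ?_⟩
  obtain rfl : s = 0 := by omega
  exact hc

end DetMachine.Reaches

/-! ### A machine that computes the permutation -/

namespace Evaluator

/-- State `0` starts, state `1` copies the input `x` to the query tape as `0x0`, state `2` begins a
round (each round moves the input head by one cell to the left) or stops, state `3` queries, state
`4` moves the answer to the output tape, states `5` and `6` prepend a `1` to the query. -/
def delta (q : Fin 8) (s : Fin 3 → Sym) : Fin 8 × (Fin 3 → Sym) × (Fin 3 → Move) :=
  match q with
  | 0 => (1, ![s 0, Sym.bit false, s 2], ![Move.stay, Move.right, Move.stay])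
  | 1 => if s 0 = Sym.blank then
      (2, ![s 0, Sym.bit false, s 2], ![Move.left, Move.stay, Move.stay])
    else (1, ![s 0, s 0, s 2], ![Move.right, Move.right, Move.stay])
  | 2 => if s 0 = Sym.blank then (7, ![s 0, s 1, s 2], ![Move.stay, Move.stay, Move.stay])
    else (3, ![s 0, s 1, s 2], ![Move.left, Move.stay, Move.stay])
  | 4 => (5, ![s 0, Sym.bit false, s 1], ![Move.stay, Move.left, Move.right])
  | 5 => if s 1 = Sym.blank then
      (6, ![s 0, Sym.bit true, s 2], ![Move.stay, Move.right, Move.stay])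
    else (5, ![s 0, s 1, s 2], ![Move.stay, Move.left, Move.stay])
  | 6 => if s 1 = Sym.blank then (2, ![s 0, s 1, s 2], ![Move.stay, Move.left, Move.stay])
    else (6, ![s 0, s 1, s 2], ![Move.stay, Move.right, Move.stay])
  | _ => (7, ![s 0, s 1, s 2], ![Move.stay, Move.stay, Move.stay])

/-- The evaluator. -/
def machine : DetMachine where
  states := 8
  work := 1
  start := 0
  final := 7
  query := 3
  answer := 4
  out := (2 : Fin 3)
  start_ne_final := by decide
  query_ne_answer := by decide
  delta := delta

/-- A configuration of the evaluator, given tape by tape. -/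
def config (q : Fin 8) (t₀ t₁ t₂ : Tape) (h₀ h₁ h₂ : ℤ) : Config machine.toFrame where
  state := q
  tape := (![t₀, t₁, t₂] : Fin 3 → Tape)
  head := (![h₀, h₁, h₂] : Fin 3 → ℤ)

theorem scan_config (q : Fin 8) (t₀ t₁ t₂ : Tape) (h₀ h₁ h₂ : ℤ) :
    (config q t₀ t₁ t₂ h₀ h₁ h₂).scan = (![t₀ h₀, t₁ h₁, t₂ h₂] : Fin 3 → Sym) := by
  funext (j : Fin 3)
  fin_cases j <;> rfl

theorem act_config (q q' : Fin 8) (t₀ t₁ t₂ : Tape) (h₀ h₁ h₂ : ℤ) (s₀ s₁ s₂ : Sym)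
    (m₀ m₁ m₂ : Move) :
    (config q t₀ t₁ t₂ h₀ h₁ h₂).act
      ((q', ![s₀, s₁, s₂], ![m₀, m₁, m₂]) : Fin 8 × (Fin 3 → Sym) × (Fin 3 → Move)) =
    config q' (t₀.update h₀ s₀) (t₁.update h₁ s₁) (t₂.update h₂ s₂)
      (h₀ + m₀.shift) (h₁ + m₁.shift) (h₂ + m₂.shift) := by
  unfold Config.act config
  congr 1
  · funext (j : Fin 3)
    fin_cases j <;> rfl
  · funext (j : Fin 3)
    fin_cases j <;> rfl

theorem step_config (A : Oracle) {q : Fin 8} (hq : q ≠ 3) (t₀ t₁ t₂ : Tape) (h₀ h₁ h₂ : ℤ) :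
    machine.step A (config q t₀ t₁ t₂ h₀ h₁ h₂) =
      (config q t₀ t₁ t₂ h₀ h₁ h₂).act (delta q ![t₀ h₀, t₁ h₁, t₂ h₂]) := by
  rw [← scan_config q]
  exact if_neg hq

theorem step_start (A : Oracle) (t₀ t₁ t₂ : Tape) (h₀ h₁ h₂ : ℤ) :
    machine.step A (config 0 t₀ t₁ t₂ h₀ h₁ h₂) =
      config 1 t₀ (t₁.update h₁ (Sym.bit false)) t₂ h₀ (h₁ + 1) h₂ := by
  rw [step_config A (by decide)]
  simp [delta, act_config, Move.shift, Finsupp.update_self]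

theorem step_copy (A : Oracle) {t₀ : Tape} (t₁ t₂ : Tape) {h₀ : ℤ} (h₁ h₂ : ℤ)
    (h : t₀ h₀ ≠ Sym.blank) :
    machine.step A (config 1 t₀ t₁ t₂ h₀ h₁ h₂) =
      config 1 t₀ (t₁.update h₁ (t₀ h₀)) t₂ (h₀ + 1) (h₁ + 1) h₂ := by
  rw [step_config A (by decide)]
  simp [delta, act_config, Move.shift, Finsupp.update_self, h]

theorem step_copied (A : Oracle) {t₀ : Tape} (t₁ t₂ : Tape) {h₀ : ℤ} (h₁ h₂ : ℤ)
    (h : t₀ h₀ = Sym.blank) :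
    machine.step A (config 1 t₀ t₁ t₂ h₀ h₁ h₂) =
      config 2 t₀ (t₁.update h₁ (Sym.bit false)) t₂ (h₀ - 1) h₁ h₂ := by
  -- Rewriting a blank cell with a blank leaves the tape unchanged.
  have h' := Finsupp.update_self t₀ h₀
  rw [h] at h'
  rw [step_config A (by decide)]
  simp [delta, act_config, Move.shift, Finsupp.update_self, h, h', sub_eq_add_neg]

theorem step_stop (A : Oracle) {t₀ : Tape} (t₁ t₂ : Tape) {h₀ : ℤ} (h₁ h₂ : ℤ)
    (h : t₀ h₀ = Sym.blank) :
    machine.step A (config 2 t₀ t₁ t₂ h₀ h₁ h₂) = config 7 t₀ t₁ t₂ h₀ h₁ h₂ := by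
  have h' := Finsupp.update_self t₀ h₀
  rw [h] at h'
  rw [step_config A (by decide)]
  simp [delta, act_config, Move.shift, Finsupp.update_self, h, h']

theorem step_round (A : Oracle) {t₀ : Tape} (t₁ t₂ : Tape) {h₀ : ℤ} (h₁ h₂ : ℤ)
    (h : t₀ h₀ ≠ Sym.blank) :
    machine.step A (config 2 t₀ t₁ t₂ h₀ h₁ h₂) = config 3 t₀ t₁ t₂ (h₀ - 1) h₁ h₂ := by
  rw [step_config A (by decide)]
  simp [delta, act_config, Move.shift, Finsupp.update_self, h, sub_eq_add_neg]

theorem step_query (A : Oracle) (t₀ t₁ t₂ : Tape) (h₀ h₁ h₂ : ℤ) :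
    machine.step A (config 3 t₀ t₁ t₂ h₀ h₁ h₂) =
      config 4 t₀ (callTape A t₁) t₂ h₀ h₁ h₂ := by
  have h : machine.step A (config 3 t₀ t₁ t₂ h₀ h₁ h₂) =
      (config 3 t₀ t₁ t₂ h₀ h₁ h₂).call A := if_pos rfl
  rw [h]
  unfold Config.call config
  congr 1
  funext (j : Fin 3)
  fin_cases j <;> rfl

theorem step_answer (A : Oracle) (t₀ t₁ t₂ : Tape) (h₀ h₁ h₂ : ℤ) :
    machine.step A (config 4 t₀ t₁ t₂ h₀ h₁ h₂) =
      config 5 t₀ (t₁.update h₁ (Sym.bit false)) (t₂.update h₂ (t₁ h₁)) h₀ (h₁ - 1) (h₂ + 1) := by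
  rw [step_config A (by decide)]
  simp [delta, act_config, Move.shift, Finsupp.update_self, sub_eq_add_neg]

theorem step_left (A : Oracle) (t₀ : Tape) {t₁ : Tape} (t₂ : Tape) (h₀ : ℤ) {h₁ : ℤ} (h₂ : ℤ)
    (h : t₁ h₁ ≠ Sym.blank) :
    machine.step A (config 5 t₀ t₁ t₂ h₀ h₁ h₂) = config 5 t₀ t₁ t₂ h₀ (h₁ - 1) h₂ := by
  rw [step_config A (by decide)]
  simp [delta, act_config, Move.shift, Finsupp.update_self, h, sub_eq_add_neg]

theorem step_prepend (A : Oracle) (t₀ : Tape) {t₁ : Tape} (t₂ : Tape) (h₀ : ℤ) {h₁ : ℤ} (h₂ : ℤ)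
    (h : t₁ h₁ = Sym.blank) :
    machine.step A (config 5 t₀ t₁ t₂ h₀ h₁ h₂) =
      config 6 t₀ (t₁.update h₁ (Sym.bit true)) t₂ h₀ (h₁ + 1) h₂ := by
  rw [step_config A (by decide)]
  simp [delta, act_config, Move.shift, Finsupp.update_self, h]

theorem step_right (A : Oracle) (t₀ : Tape) {t₁ : Tape} (t₂ : Tape) (h₀ : ℤ) {h₁ : ℤ} (h₂ : ℤ)
    (h : t₁ h₁ ≠ Sym.blank) :
    machine.step A (config 6 t₀ t₁ t₂ h₀ h₁ h₂) = config 6 t₀ t₁ t₂ h₀ (h₁ + 1) h₂ := by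
  rw [step_config A (by decide)]
  simp [delta, act_config, Move.shift, Finsupp.update_self, h]

theorem step_end (A : Oracle) (t₀ : Tape) {t₁ : Tape} (t₂ : Tape) (h₀ : ℤ) {h₁ : ℤ} (h₂ : ℤ)
    (h : t₁ h₁ = Sym.blank) :
    machine.step A (config 6 t₀ t₁ t₂ h₀ h₁ h₂) = config 2 t₀ t₁ t₂ h₀ (h₁ - 1) h₂ := by
  have h' := Finsupp.update_self t₁ h₁
  rw [h] at h'
  rw [step_config A (by decide)]
  simp [delta, act_config, Move.shift, Finsupp.update_self, h, h', sub_eq_add_neg]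

theorem reaches_single {A : Oracle} {q : Fin 8} (hq : q ≠ 7) {t₀ t₁ t₂ : Tape} {h₀ h₁ h₂ : ℤ}
    {c : Config machine.toFrame} (h : machine.step A (config q t₀ t₁ t₂ h₀ h₁ h₂) = c) :
    machine.Reaches A (config q t₀ t₁ t₂ h₀ h₁ h₂) 1 c :=
  DetMachine.Reaches.single hq h

theorem reaches_left (A : Oracle) (t₀ t₁ t₂ : Tape) (h₀ h₁ h₂ : ℤ) (k : ℕ)
    (h : ∀ j < k, t₁ (h₁ - j) ≠ Sym.blank) :
    machine.Reaches A (config 5 t₀ t₁ t₂ h₀ h₁ h₂) k (config 5 t₀ t₁ t₂ h₀ (h₁ - k) h₂) := by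
  induction k with
  | zero => simpa using DetMachine.Reaches.refl _
  | succ k ih =>
    have h1 := (ih fun j hj => h j (by omega)).trans
      (reaches_single (by decide) (step_left A t₀ t₂ h₀ h₂ (h k (by omega))))
    rwa [show h₁ - k - 1 = h₁ - (k + 1 : ℕ) by push_cast; ring] at h1

theorem reaches_right (A : Oracle) (t₀ t₁ t₂ : Tape) (h₀ h₁ h₂ : ℤ) (k : ℕ)
    (h : ∀ j < k, t₁ (h₁ + j) ≠ Sym.blank) :
    machine.Reaches A (config 6 t₀ t₁ t₂ h₀ h₁ h₂) k (config 6 t₀ t₁ t₂ h₀ (h₁ + k) h₂) := by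
  induction k with
  | zero => simpa using DetMachine.Reaches.refl _
  | succ k ih =>
    have h1 := (ih fun j hj => h j (by omega)).trans
      (reaches_single (by decide) (step_right A t₀ t₂ h₀ h₂ (h k (by omega))))
    rwa [show h₁ + k + 1 = h₁ + (k + 1 : ℕ) by push_cast; ring] at h1

theorem reaches_copy (A : Oracle) (x : List Bool) (k : ℕ) (hk : k ≤ x.length) :
    machine.Reaches A (config 1 (wordTape 0 x) (wordTape 0 [false]) 0 0 1 0) k
      (config 1 (wordTape 0 x) (wordTape 0 (false :: x.take k)) 0 k (k + 1) 0) := by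
  induction k with
  | zero => simpa using DetMachine.Reaches.refl _
  | succ k ih =>
    have hx := wordTape_add 0 x k hk
    rw [zero_add] at hx
    have h1 := (ih (by omega)).trans (reaches_single (by decide)
      (step_copy A (wordTape 0 (false :: x.take k)) 0 (h₀ := k) (k + 1) 0 (by rw [hx]; simp)))
    have h2 := wordTape_concat 0 (false :: x.take k) x[k]
    have h3 : (0 : ℤ) + (false :: x.take k).length = k + 1 := by
      simp only [List.length_cons, List.length_take]
      push_cast
      omega
    rw [h3, List.cons_append, List.take_concat_get' x k hk] at h2
    rw [hx, h2] at h1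
    push_cast
    exact h1

theorem length_pair (x : List Bool) (i : ℕ) : (pair x i).length = x.length + i + 1 := by
  simp [pair]
  omega

theorem pair_succ (x : List Bool) (i : ℕ) : pair x (i + 1) = true :: pair x i := by
  simp [pair, List.replicate_succ]

/-- The loop invariant: after `i` rounds the query tape holds the code of `(x, i)` followed by a
cleared answer bit, extended leftwards to cell `-i`, and the first `i` bits of the image have been
output. The input head, moving left from the last cell, counts the rounds. The sweeps to the left
and to the right take `n + i + 1` and `n + i + 2` steps; the five other steps complete the count. -/
theorem reaches_round (π : Permutations) (x : List Bool) (i : ℕ) (hi : i < x.length) :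
    machine.Reaches π.oracle
      (config 2 (wordTape 0 x) (wordTape (-i) (pair x i ++ [false]))
        (wordTape 0 ((π.toFun x).take i)) (x.length - 1 - i) (x.length + 1) i)
      (2 * x.length + 2 * i + 8)
      (config 2 (wordTape 0 x) (wordTape (-(i + 1 : ℕ)) (pair x (i + 1) ++ [false]))
        (wordTape 0 ((π.toFun x).take (i + 1))) (x.length - 1 - (i + 1 : ℕ)) (x.length + 1)
        (i + 1 : ℕ)) := by
  set n := x.length with hn
  set A := π.oracle
  have hπ : i < (π.toFun x).length := by rwa [π.length_toFun]
  set b := (π.toFun x)[i]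
  have hA : A (pair x i) = b := by
    simp [A, oracle_pair, b, hπ]
  have hlen := length_pair x i
  rw [← hn] at hlen
  have hend : -(i : ℤ) + (pair x i).length = n + 1 := by
    rw [hlen]
    push_cast
    ring
  have s1 := reaches_single (by decide) (step_round A (t₀ := wordTape 0 x)
    (wordTape (-i) (pair x i ++ [false])) (wordTape 0 ((π.toFun x).take i))
    (h₀ := n - 1 - i) (n + 1) i ((wordTape_ne_blank _ _ _).2 ⟨by omega, by omega⟩))
  rw [show (n : ℤ) - 1 - i - 1 = n - 1 - (i + 1 : ℕ) by push_cast; ring] at s1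
  have s2 := s1.trans (reaches_single (by decide) (step_query A _ _ _ _ _ _))
  rw [callTape_wordTape, hA, Bool.false_xor] at s2
  have s3 := s2.trans (reaches_single (by decide) (step_answer A _ _ _ _ _ _))
  have hread : wordTape (-i) (pair x i ++ [b]) (n + 1) = Sym.bit b := by
    rw [← hend, wordTape_add _ _ _ (by simp)]
    simp
  have hreset := wordTape_overwrite (-i) (pair x i) b false
  rw [hend] at hreset
  have hout := wordTape_concat 0 ((π.toFun x).take i) b
  rw [List.length_take, min_eq_left hπ.le, zero_add, List.take_concat_get' _ _ hπ] at hout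
  rw [hread, hreset, hout] at s3
  have s4 := s3.trans (reaches_left A _ _ _ _ _ _ (n + i + 1) (by
    intro j hj
    rw [wordTape_ne_blank]
    simp only [List.length_append, List.length_singleton, hlen]
    push_cast
    omega))
  rw [show (n : ℤ) + 1 - 1 - (n + i + 1 : ℕ) = -i - 1 by push_cast; ring] at s4
  have s5 := s4.trans (reaches_single (by decide)
    (step_prepend A _ _ _ _ (wordTape_eq_blank (Or.inl (by omega)))))
  rw [wordTape_cons, ← List.cons_append, ← pair_succ,
    show -(i : ℤ) - 1 = -(i + 1 : ℕ) by push_cast; ring] at s5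
  have hlen' := length_pair x (i + 1)
  rw [← hn] at hlen'
  have s6 := s5.trans (reaches_right A _ _ _ _ _ _ (n + i + 2) (by
    intro j hj
    rw [wordTape_ne_blank]
    simp only [List.length_append, List.length_singleton, hlen']
    push_cast
    omega))
  have s7 := s6.trans (reaches_single (by decide) (step_end A _ _ _ _ (wordTape_eq_blank (by
    right
    simp only [List.length_append, List.length_singleton, hlen']
    push_cast
    omega))))
  convert s7 using 1
  · omega
  · congr 1
    push_cast
    ring

theorem reaches_rounds (π : Permutations) (x : List Bool) (i : ℕ) (hi : i ≤ x.length) :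
    ∃ k ≤ i * (4 * x.length + 8), machine.Reaches π.oracle
      (config 2 (wordTape 0 x) (wordTape 0 (pair x 0 ++ [false])) 0
        (x.length - 1) (x.length + 1) 0) k
      (config 2 (wordTape 0 x) (wordTape (-i) (pair x i ++ [false]))
        (wordTape 0 ((π.toFun x).take i)) (x.length - 1 - i) (x.length + 1) i) := by
  induction i with
  | zero => exact ⟨0, by simp, by simpa [wordTape_nil] using DetMachine.Reaches.refl _⟩
  | succ i ih =>
    obtain ⟨k, hk, h⟩ := ih (by omega)
    refine ⟨_, ?_, h.trans (reaches_round π x i hi)⟩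
    -- As `i < x.length`, a round costs at most `4 * x.length + 8` steps.
    nlinarith

theorem init_eq (x : List Bool) :
    Config.init machine.toFrame x = config 0 (wordTape 0 x) 0 0 0 0 0 := by
  unfold Config.init config
  congr 1
  · funext (j : Fin 3)
    fin_cases j <;> rfl
  · funext (j : Fin 3)
    fin_cases j <;> rfl

/-- Besides the rounds there are `n` copying steps and three single ones: the start, the end of the
copying, and the stop when the input head runs off the left end. -/
theorem computesInTime (π : Permutations) :
    machine.ComputesInTime π.oracle π.toFun fun n => n * (4 * n + 8) + n + 3 := by
  intro x
  obtain ⟨k, hk, h⟩ := reaches_rounds π x x.length le_rfl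
  have s1 := reaches_single (by decide) (step_start π.oracle (wordTape 0 x) 0 0 0 0 0)
  rw [← wordTape_nil 0] at s1
  have h0 := wordTape_concat 0 [] false
  simp only [List.length_nil, Nat.cast_zero, add_zero, List.nil_append] at h0
  rw [h0, wordTape_nil, zero_add] at s1
  have s2 := s1.trans (reaches_copy π.oracle x x.length le_rfl)
  have s3 := s2.trans (reaches_single (by decide) (step_copied π.oracle _ _ _ _
    (wordTape_eq_blank (by right; simp))))
  have h1 := wordTape_concat 0 (false :: x) false
  have h2 : (0 : ℤ) + (false :: x).length = x.length + 1 := by simp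
  rw [h2] at h1
  rw [List.take_length, h1] at s3
  have s4 := (s3.trans h).trans (reaches_single (by decide) (step_stop π.oracle _ _ _ _
    (wordTape_eq_blank (by left; omega))))
  rw [← init_eq] at s4
  refine ⟨_, ?_, ⟨?_, s4.2⟩, ?_⟩
  · dsimp only
    omega
  · change ((machine.step π.oracle)^[_] _).state = _
    rw [s4.1]
    rfl
  · refine ⟨0, ?_⟩
    change ((machine.step π.oracle)^[_] _).tape machine.out = _
    rw [s4.1]
    change wordTape 0 _ = _
    rw [List.take_of_length_le (π.length_toFun x).le]

end Evaluator

end OracleTM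

theorem corollary3p7 :
    ∃ (C : OracleTM.DetMachine) (p : Polynomial ℕ),
      ∀ᵐ π ∂OracleTM.randomPermutations,
        Function.Bijective π.toFun ∧
        (∀ x : List Bool, (π.toFun x).length = x.length) ∧
        C.ComputesInTime π.oracle π.toFun (fun n => p.eval n) ∧
        ∀ M : OracleTM.QuantumMachine, M.WellFormed →
          ∀ T : ℕ → ℕ, M.InvertsInTime π.oracle π.toFun T →
            (fun n : ℕ => (2 : ℝ) ^ ((n : ℝ) / 3)) =O[Filter.atTop] (fun n : ℕ => (T n : ℝ)) := by
  refine ⟨OracleTM.Evaluator.machine,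
    .X * (4 * .X + 8) + .X + 3, ?_⟩
  filter_upwards [OracleTM.ae_forall_isBigO] with π hπ
  refine ⟨π.bijective_toFun, π.length_toFun, ?_, hπ⟩
  simpa using OracleTM.Evaluator.computesInTime π
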